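/- Proposition (polygon spaces after adding a tiny edge). Let $e_1$ be the first vector of the standard basis of $\mathbb R^d$. For $k\ge 1$ and $c=(c_1,\dots,c_k)\in\mathbb R_{>0}^k$ let $$\mathcal C^k_d(c)=\Big\{(z_1,\dots,z_{k-1})\in (S^{d-1})^{k-1}\ \Big|\ \sum_{i=1}^{k-1}c_iz_i=c_k e_1\Big\}$$ be the chain space and let $\mathcal N^k_d(c)=SO(d-1)\backslash\mathcal C^k_d(c)$ be the polygon space, where $SO(d-1)$ is the subgroup of $SO(d)$ stabilizing $e_1$, acting diagonally. Call $c$ generic if $\mathcal C^k_1(c)=\emptyset$. The chambers of $\mathbb R^k_{\nearrow}=\{c\in\mathbb R^k\mid 0<c_1\le\dots\le c_k\}$ are the connected components of its subset of generic elements. For generic $c$, the space $\mathcal C^k_3(c)$ is a closed smooth manifold on which $S^1=SO(2)$ acts freely, so $\mathcal C^k_3(c)\to\mathcal N^k_3(c)$ is a principal circle bundle over a closed smooth manifold. Let $m\ge 2$ and let $\alpha$ be a chamber of $\mathbb R^{m-1}_{\nearrow}$. Let $\alpha^+$ be the chamber of $\mathbb R^m_{\nearrow}$ which contains $(\delta,c_2,\dots,c_m)$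 for $(c_2,\dots,c_m)\in\alpha$ and all small enough $\delta>0$. Then, for every $b\in\alpha$ and every $a\in\alpha^+$, the following spaces are smooth manifolds of dimension $2(m-3)$ (they are empty if $m\le 3$), and: (a) $\mathcal N^m_3(a)$ is diffeomorphic to $S^2\times_{S^1}\mathcal C^{m-1}_3(b)$, the quotient of $S^2\times\mathcal C^{m-1}_3(b)$ by the diagonal action of $S^1=SO(2)$ (which acts on $S^2\subset\mathbb R^3$ by rotations about the axis $e_1$). (b) $\mathcal N^m_3(a)$ is diffeomorphic to the double of $\mathcal D=D^2\times_{S^1}\mathcal C^{m-1}_3(b)$, the total space of the $D^2$-disk bundle associated with the circle bundle $\mathcal C^{m-1}_3(b)\to\mathcal N^{m-1}_3(b)$. The double is the union of two copies of $\mathcal D$ (with opposite orientations) along their common boundary, with the smooth structure obtained by gluing along the radial collars $(t,[v,z])\mapsto[(1-t)v,z]$, $0\le t<1$, $\|v\|=1$, of the boundary. -/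

import Mathlib

open scoped Manifold ContDiff Topology

noncomputable section

namespace PolygonSpaces

/-! ### Smooth spaces: smooth structures given by their sheaves of smooth functions -/

/-- A smooth structure on a topological space, given by its sheaf of smooth real functions:
`smoothOn f U` says that `f`, of which only the restriction to the open set `U` matters,
is a smooth function on `U`. -/
class SmoothFunctions (X : Type*) [TopologicalSpace X] where
  smoothOn : (X → ℝ) → Set X → Prop
  congr : ∀ {f g : X → ℝ} {U : Set X}, IsOpen U → (∀ x ∈ U, f x = g x) →
    smoothOn f U → smoothOn g U
  mono : ∀ {f : X → ℝ} {U V : Set X}, IsOpen U → IsOpen V → V ⊆ U →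
    smoothOn f U → smoothOn f V
  glue : ∀ {f : X → ℝ} {U : Set X}, IsOpen U →
    (∀ x ∈ U, ∃ V, IsOpen V ∧ x ∈ V ∧ V ⊆ U ∧ smoothOn f V) → smoothOn f U

open SmoothFunctions (smoothOn)

/-- A subset of a normed space: a function is smooth if it extends, locally around each
point, to a `C^∞` function on an open subset of the ambient space. -/
instance subsetSmooth {V : Type*} [NormedAddCommGroup V] [NormedSpace ℝ V] (S : Set V) :
    SmoothFunctions S where
  smoothOn f U := ∀ x ∈ U, ∃ (W : Set V) (F : V → ℝ), IsOpen W ∧ (x : V) ∈ W ∧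
    ContDiffOn ℝ ∞ F W ∧ ∀ y : S, (y : V) ∈ W → f y = F y
  congr := by
    intro f g U hU hfg hf x hx
    obtain ⟨W, F, hW, hxW, hF, h⟩ := hf x hx
    obtain ⟨U', hU', rfl⟩ := isOpen_induced_iff.1 hU
    exact ⟨W ∩ U', F, hW.inter hU', ⟨hxW, hx⟩, hF.mono Set.inter_subset_left,
      fun y hy => by rw [← hfg y hy.2, h y hy.1]⟩
  mono := fun _ _ hVU hf x hx => hf x (hVU hx)
  glue := by
    intro f U _ h x hx
    obtain ⟨V, _, hxV, _, hf⟩ := h x hx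
    exact hf x hxV

/-- A quotient space: a function is smooth if its composition with the projection is. -/
instance quotientSmooth {X : Type*} [TopologicalSpace X] [SmoothFunctions X] (s : Setoid X) :
    SmoothFunctions (Quotient s) where
  smoothOn f U := smoothOn (fun x : X => f (Quotient.mk s x)) (Quotient.mk s ⁻¹' U)
  congr := fun hU h hf => SmoothFunctions.congr (hU.preimage continuous_quotient_mk')
    (fun x hx => h _ hx) hf
  mono := fun hU hV hVU hf => SmoothFunctions.mono (hU.preimage continuous_quotient_mk')
    (hV.preimage continuous_quotient_mk') (Set.preimage_mono hVU) hf
  glue := by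
    intro f U hU h
    refine SmoothFunctions.glue (hU.preimage continuous_quotient_mk') fun x hx => ?_
    obtain ⟨V, hV, hxV, hVU, hf⟩ := h _ hx
    exact ⟨_, hV.preimage continuous_quotient_mk', hxV, Set.preimage_mono hVU, hf⟩

/-- A smooth chart of `X`: a homeomorphism of an open subset of `X` onto an open subset
of `ℝⁿ` under which the smooth functions on `X` correspond to the `C^∞` functions. -/
def IsSmoothChart {X : Type*} [TopologicalSpace X] [SmoothFunctions X] {n : ℕ}
    (φ : OpenPartialHomeomorph X (EuclideanSpace ℝ (Fin n))) : Prop :=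
  ∀ (U : Set X) (f : X → ℝ), IsOpen U → U ⊆ φ.source →
    (smoothOn f U ↔ ContDiffOn ℝ ∞ (f ∘ φ.symm) (φ '' U))

/-- `X`, with its given smooth functions, is a smooth manifold of dimension `n`
(without boundary). -/
structure IsSmoothManifold (n : ℕ) (X : Type*) [TopologicalSpace X] [SmoothFunctions X] :
    Prop where
  t2 : T2Space X
  secondCountable : SecondCountableTopology X
  exists_chart : ∀ x : X, ∃ φ : OpenPartialHomeomorph X (EuclideanSpace ℝ (Fin n)),
    IsSmoothChart φ ∧ x ∈ φ.source

/-- The charted space structure consisting of all smooth charts. -/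
@[reducible]
def IsSmoothManifold.chartedSpace {n : ℕ} {X : Type*} [TopologicalSpace X]
    [SmoothFunctions X] (h : IsSmoothManifold n X) :
    ChartedSpace (EuclideanSpace ℝ (Fin n)) X where
  atlas := {φ | IsSmoothChart φ}
  chartAt x := (h.exists_chart x).choose
  mem_chart_source x := (h.exists_chart x).choose_spec.2
  chart_mem_atlas x := (h.exists_chart x).choose_spec.1

/-- The smooth charts form a `C^∞` atlas. -/
theorem IsSmoothManifold.isManifold {n : ℕ} {X : Type*} [TopologicalSpace X]
    [SmoothFunctions X] (h : IsSmoothManifold n X) :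
    let _ := h.chartedSpace
    IsManifold (𝓡 n) ∞ X := by
  let _ := h.chartedSpace
  refine isManifold_of_contDiffOn _ _ _ fun φ ψ hφ hψ => ?_
  replace hφ : IsSmoothChart φ := hφ
  replace hψ : IsSmoothChart ψ := hψ
  have key : ContDiffOn ℝ ∞ (fun y => ψ (φ.symm y)) (φ.symm ≫ₕ ψ).source := by
    rw [contDiffOn_euclidean]
    intro i
    have hopen : IsOpen (φ.source ∩ ψ.source) := φ.open_source.inter ψ.open_source
    have h1 : smoothOn (fun x => (ψ x) i) (φ.source ∩ ψ.source) := by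
      rw [hψ _ _ hopen Set.inter_subset_right]
      have h2 : ContDiffOn ℝ ∞ (fun y : EuclideanSpace ℝ (Fin n) => y i)
          (ψ '' (φ.source ∩ ψ.source)) :=
        (EuclideanSpace.proj (𝕜 := ℝ) i).contDiff.contDiffOn
      refine h2.congr ?_
      rintro _ ⟨x, hx, rfl⟩
      simp [ψ.left_inv hx.2]
    rw [hφ _ _ hopen Set.inter_subset_left] at h1
    refine h1.mono ?_
    intro y hy
    simp only [OpenPartialHomeomorph.trans_source, OpenPartialHomeomorph.symm_source,
      Set.mem_inter_iff, Set.mem_preimage] at hy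
    exact ⟨φ.symm y, ⟨φ.map_target hy.1, hy.2⟩, φ.right_inv hy.1⟩
  simpa [Function.comp_def] using key

/-- `X` and `Y` are smooth `n`-manifolds, and there is a diffeomorphism between them. -/
def AreDiffeomorphic (n : ℕ) (X Y : Type*) [TopologicalSpace X] [SmoothFunctions X]
    [TopologicalSpace Y] [SmoothFunctions Y] : Prop :=
  ∃ (hX : IsSmoothManifold n X) (hY : IsSmoothManifold n Y),
    letI := hX.chartedSpace
    letI := hY.chartedSpace
    Nonempty (Diffeomorph (𝓡 n) (𝓡 n) X Y ∞)

/-! ### Chains, generic length vectors, chambers -/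

/-- The first vector of the standard basis of `ℝᵈ`. -/
def e₁ (d : ℕ) [NeZero d] : EuclideanSpace ℝ (Fin d) := EuclideanSpace.single 0 1

/-- The chain space `𝒞ᵐ_d(a)` of `a = (a₁, …, a_m)`, where `m = n + 1`. -/
def chains (d : ℕ) [NeZero d] {n : ℕ} (a : Fin (n + 1) → ℝ) :
    Set (Fin n → EuclideanSpace ℝ (Fin d)) :=
  {z | (∀ i, ‖z i‖ = 1) ∧ ∑ i, a i.castSucc • z i = a (Fin.last n) • e₁ d}

/-- The generic elements of `ℝᵐ_↗ = {0 < a₁ ≤ ⋯ ≤ a_m}`, where `m = n + 1`: those for which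
there is no lined chain. -/
def genericOrdered (n : ℕ) : Set (Fin (n + 1) → ℝ) :=
  {a | (∀ i, 0 < a i) ∧ Monotone a ∧ chains 1 a = ∅}

/-- The chamber of `a` in `ℝᵐ_↗`: its connected component in the set of generic elements. -/
def chamberOf {n : ℕ} (a : Fin (n + 1) → ℝ) : Set (Fin (n + 1) → ℝ) :=
  connectedComponentIn (genericOrdered n) a

/-- `α` is a chamber of `ℝᵐ_↗`. -/
def IsChamber {n : ℕ} (α : Set (Fin (n + 1) → ℝ)) : Prop :=
  ∃ a ∈ genericOrdered n, α = chamberOf a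

/-- The chamber `α⁺` obtained from `α` by adding a tiny edge: the chamber of
`(δ, a₂, …, a_m)` for `(a₂, …, a_m) ∈ α` and all small enough `δ > 0`. -/
def plusChamber {n : ℕ} (α : Set (Fin (n + 1) → ℝ)) : Set (Fin (n + 2) → ℝ) :=
  {a' | ∃ a ∈ α, ∃ ε > 0, ∀ δ ∈ Set.Ioc (0 : ℝ) ε,
    (Fin.cons δ a : Fin (n + 2) → ℝ) ∈ genericOrdered (n + 1) ∧
      a' ∈ chamberOf (Fin.cons δ a : Fin (n + 2) → ℝ)}

/-! ### Rotations about the first axis, polygon spaces, associated bundles -/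

/-- `SO(d-1)`, seen as the subgroup of `SO(d)` stabilizing the first axis pointwise. -/
def axisRotations (d : ℕ) [NeZero d] :
    Subgroup (EuclideanSpace ℝ (Fin d) ≃ₗ[ℝ] EuclideanSpace ℝ (Fin d)) where
  carrier := {A | (∀ x, ‖A x‖ = ‖x‖) ∧ LinearEquiv.det A = 1 ∧ A (e₁ d) = e₁ d}
  mul_mem' := by
    rintro A B ⟨hA, hA', hA''⟩ ⟨hB, hB', hB''⟩
    exact ⟨fun x => by simp [hA, hB], by simp [hA', hB'], by simp [hA'', hB'']⟩
  one_mem' := ⟨fun x => rfl, map_one _, rfl⟩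
  inv_mem' := by
    rintro A ⟨hA, hA', hA''⟩
    refine ⟨fun x => ?_, by rw [map_inv, hA', inv_one], ?_⟩
    · rw [← hA (A⁻¹ x)]
      exact congrArg norm (A.apply_symm_apply x)
    · exact (LinearEquiv.symm_apply_eq A).2 hA''.symm

/-- For an `SO(d-1)`-invariant subset `S` of a space `V` on which `SO(d-1)` acts, the relation
of lying in the same orbit. -/
@[reducible]
def orbitSetoid (d : ℕ) [NeZero d] {V : Type*} [MulAction (axisRotations d) V] (S : Set V) :
    Setoid S :=
  (MulAction.orbitRel (axisRotations d) V).comap Subtype.val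

/-- The polygon space `𝒩ᵐ_d(a) = SO(d-1) \ 𝒞ᵐ_d(a)`. -/
abbrev PolygonSpace (d : ℕ) [NeZero d] {n : ℕ} (a : Fin (n + 1) → ℝ) : Type :=
  Quotient (orbitSetoid d (chains d a))

/-- `S² × 𝒞ᵐ_3(a)`. -/
def sphereTimesChains {n : ℕ} (a : Fin (n + 1) → ℝ) :
    Set (EuclideanSpace ℝ (Fin 3) × (Fin n → EuclideanSpace ℝ (Fin 3))) :=
  {p | ‖p.1‖ = 1 ∧ p.2 ∈ chains 3 a}

/-- `S² ×_{S¹} 𝒞ᵐ_3(a)`, the quotient of `S² × 𝒞ᵐ_3(a)` by the diagonal action of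
`S¹ = SO(2)`. -/
abbrev SphereBundle {n : ℕ} (a : Fin (n + 1) → ℝ) : Type :=
  Quotient (orbitSetoid 3 (sphereTimesChains a))

/-- `D² × 𝒞ᵐ_3(a)`, where `D²` is the unit disk of the plane orthogonal to the first axis, on
which `SO(2)` acts by rotations. -/
def diskTimesChains {n : ℕ} (a : Fin (n + 1) → ℝ) :
    Set (EuclideanSpace ℝ (Fin 3) × (Fin n → EuclideanSpace ℝ (Fin 3))) :=
  {p | p.1 0 = 0 ∧ ‖p.1‖ ≤ 1 ∧ p.2 ∈ chains 3 a}

/-- The total space `D² ×_{S¹} 𝒞ᵐ_3(a)` of the disk bundle associated with the circle bundle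
`𝒞ᵐ_3(a) → 𝒩ᵐ_3(a)`. -/
abbrev DiskBundle {n : ℕ} (a : Fin (n + 1) → ℝ) : Type :=
  Quotient (orbitSetoid 3 (diskTimesChains a))

/-- The boundary `S¹ ×_{S¹} 𝒞ᵐ_3(a)` of the disk bundle. -/
def diskBundleBoundary {n : ℕ} (a : Fin (n + 1) → ℝ) : Set (DiskBundle a) :=
  {x | ∃ p : diskTimesChains a, ‖p.1.1‖ = 1 ∧ Quotient.mk _ p = x}

/-! ### The double of the disk bundle -/

/-- The relation on two copies of the disk bundle which identifies the two copies of each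
boundary point. -/
@[reducible]
def doubleSetoid {n : ℕ} (a : Fin (n + 1) → ℝ) : Setoid (Bool × DiskBundle a) where
  r x y := x.2 = y.2 ∧ (x.1 = y.1 ∨ x.2 ∈ diskBundleBoundary a)
  iseqv :=
    { refl := fun x => ⟨rfl, Or.inl rfl⟩
      symm := fun {x y} h => ⟨h.1.symm, h.2.imp Eq.symm fun hx => h.1 ▸ hx⟩
      trans := fun {x y z} h h' => ⟨h.1.trans h'.1, by
        rcases h.2 with h2 | h2
        · rcases h'.2 with h3 | h3
          · exact Or.inl (h2.trans h3)
          · exact Or.inr (h.1 ▸ h3)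
        · exact Or.inr h2⟩ }

/-- The double of the disk bundle: the union of two copies of it along their common boundary. -/
def Double {n : ℕ} (a : Fin (n + 1) → ℝ) : Type := Quotient (doubleSetoid a)

instance {n : ℕ} (a : Fin (n + 1) → ℝ) : TopologicalSpace (Double a) :=
  inferInstanceAs (TopologicalSpace (Quotient (doubleSetoid a)))

/-- The inclusions of the two copies of the disk bundle into the double. -/
def Double.incl {n : ℕ} {a : Fin (n + 1) → ℝ} (s : Bool) (x : DiskBundle a) : Double a :=
  Quotient.mk (doubleSetoid a) (s, x)

/-- `(-1, 1) × S¹ × 𝒞ᵐ_3(a)`. -/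
def collarDomain {n : ℕ} (a : Fin (n + 1) → ℝ) :
    Set (ℝ × EuclideanSpace ℝ (Fin 3) × (Fin n → EuclideanSpace ℝ (Fin 3))) :=
  {p | |p.1| < 1 ∧ p.2.1 0 = 0 ∧ ‖p.2.1‖ = 1 ∧ p.2.2 ∈ chains 3 a}

/-- The map `(t, v, z) ↦ ((1 - |t|) v, z)`. -/
def radial {n : ℕ} {a : Fin (n + 1) → ℝ} (p : collarDomain a) : diskTimesChains a :=
  ⟨((1 - |p.1.1|) • p.1.2.1, p.1.2.2), by
    obtain ⟨⟨t, v, z⟩, ht, h0, hv, hz⟩ := p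
    refine ⟨by simpa using Or.inr h0, ?_, hz⟩
    have h := abs_nonneg t
    simp only at ht hv
    simp only [norm_smul, hv, mul_one, Real.norm_eq_abs]
    rw [abs_le]
    constructor <;> linarith⟩

/-- The bicollar of the common boundary in the double which is obtained from the radial
collars of the boundary in the two copies of the disk bundle: `(t, v, z)` goes to the class of
`((1 - |t|) v, z)`, in the first copy if `t ≥ 0` and in the second copy if `t ≤ 0`. -/
def bicollar {n : ℕ} {a : Fin (n + 1) → ℝ} (p : collarDomain a) : Double a :=
  if 0 ≤ p.1.1 then Double.incl true (Quotient.mk _ (radial p))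
  else Double.incl false (Quotient.mk _ (radial p))

theorem Double.continuous_incl {n : ℕ} {a : Fin (n + 1) → ℝ} (s : Bool) :
    Continuous (Double.incl (a := a) s) :=
  (continuous_quotient_mk' (s := doubleSetoid a)).comp (Continuous.prodMk_right s)

theorem continuous_bicollar {n : ℕ} {a : Fin (n + 1) → ℝ} :
    Continuous (bicollar (a := a)) := by
  have hr : Continuous (radial (a := a)) := by
    unfold radial
    fun_prop
  have hq : Continuous fun p : collarDomain a =>
      (Quotient.mk (orbitSetoid 3 (diskTimesChains a)) (radial p)) :=
    (continuous_quotient_mk' (s := orbitSetoid 3 (diskTimesChains a))).comp hr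
  refine Continuous.if_le ((Double.continuous_incl true).comp hq)
    ((Double.continuous_incl false).comp hq) continuous_const (by fun_prop) ?_
  intro p hp
  refine Quotient.sound (s := doubleSetoid a) ⟨rfl, Or.inr ⟨radial p, ?_, rfl⟩⟩
  simp [radial, ← hp, p.2.2.2.1]

/-- The smooth structure of the double: two copies of the disk bundle are glued along their
boundary by means of the radial collars. A function is smooth if its restrictions to both
copies are smooth and it is smooth in the coordinates of the bicollar. -/
instance {n : ℕ} (a : Fin (n + 1) → ℝ) : SmoothFunctions (Double a) where
  smoothOn f U :=
    (∀ s : Bool, smoothOn (fun x => f (Double.incl s x)) (Double.incl s ⁻¹' U)) ∧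
      smoothOn (fun p => f (bicollar p)) (bicollar ⁻¹' U)
  congr := fun hU h hf =>
    ⟨fun s => SmoothFunctions.congr (hU.preimage (Double.continuous_incl s))
      (fun x hx => h _ hx) (hf.1 s),
    SmoothFunctions.congr (hU.preimage continuous_bicollar) (fun x hx => h _ hx) hf.2⟩
  mono := fun hU hV hVU hf =>
    ⟨fun s => SmoothFunctions.mono (hU.preimage (Double.continuous_incl s))
      (hV.preimage (Double.continuous_incl s)) (Set.preimage_mono hVU) (hf.1 s),
    SmoothFunctions.mono (hU.preimage continuous_bicollar) (hV.preimage continuous_bicollar)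
      (Set.preimage_mono hVU) hf.2⟩
  glue := by
    intro f U hU h
    refine ⟨fun s => SmoothFunctions.glue (hU.preimage (Double.continuous_incl s))
      fun x hx => ?_, SmoothFunctions.glue (hU.preimage continuous_bicollar) fun x hx => ?_⟩
    · obtain ⟨V, hV, hxV, hVU, hf⟩ := h _ hx
      exact ⟨_, hV.preimage (Double.continuous_incl s), hxV, Set.preimage_mono hVU, hf.1 s⟩
    · obtain ⟨V, hV, hxV, hVU, hf⟩ := h _ hx
      exact ⟨_, hV.preimage continuous_bicollar, hxV, Set.preimage_mono hVU, hf.2⟩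

end PolygonSpaces

end

noncomputable section

namespace PolygonSpaces

open SmoothFunctions (smoothOn)

/-! ### Isomorphisms of smooth spaces -/

/-! The proof lets the tiny edge shrink all the way to length zero. A chain with lengths `(0, b)` is
a free point of the sphere together with a chain for `b`, so its chain space is `S² × 𝒞(b)`, with
the diagonal action (`equivariantDiffeo_cons_zero`). The vector `(0, b)` is not a positive length
vector, but it still admits no lined chain; `weaklyGeneric` is the enlarged parameter set that
contains it. For every choice of signs the lined sums of `(0, b)` and of `a` have the same strict
sign, so the segment joining them stays in `weaklyGeneric`. It remains to see that the equivariant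
diffeomorphism type of the chain space is constant along this segment.

This is `eventually_equivariantDiffeo`. A chain `z` for lengths `c` is deformed to one for nearby
lengths `c'` by applying a single conformal map `boost w` of the sphere to all its vectors, with `w`
chosen so that the new chain closes up. The derivative of the closing condition at `w = 0` is `2 ∑
cᵢ (1 - zᵢ zᵢᵀ)`, which is injective because the edges of positive length are not collinear
(`eq_zero_of_sum_projection_eq_zero`). The implicit function theorem and compactness give a unique
small `w`, smooth in `z`. Uniqueness makes the deformation equivariant, and makes the deformation
back, by `-w`, its inverse. Passing to orbits yields (a) as an isomorphism of sheaves of smooth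
functions.

The polygon space is a manifold because some vector of each chain lies off the axis: rotating it
into a fixed half plane selects one representative of each nearby orbit, and these representatives
form a regular level set (`sliceDeriv_surjective`).

For (b), polar coordinates map each disk onto a hemisphere, equivariantly. The glued map from the
double to the sphere bundle is a continuous bijection from a compact space to a Hausdorff one.
Radial collars correspond to the coordinates `(sin, cos)` across the equator, so smoothness can be
tested in the bicollar away from the poles and in a disk at the poles (`smoothIso_double`). -/

/-- Two smooth spaces are isomorphic: there is a homeomorphism under which the smooth functions
correspond to each other. -/
def SmoothIso (X Y : Type*) [TopologicalSpace X] [SmoothFunctions X]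
    [TopologicalSpace Y] [SmoothFunctions Y] : Prop :=
  ∃ e : X ≃ₜ Y, ∀ (U : Set Y) (f : Y → ℝ), IsOpen U →
    (smoothOn f U ↔ smoothOn (fun x => f (e x)) (e ⁻¹' U))

section SmoothIso

variable {X Y Z : Type*} [TopologicalSpace X] [SmoothFunctions X]
  [TopologicalSpace Y] [SmoothFunctions Y] [TopologicalSpace Z] [SmoothFunctions Z]

theorem SmoothIso.symm (h : SmoothIso X Y) : SmoothIso Y X := by
  obtain ⟨e, he⟩ := h
  refine ⟨e.symm, fun U f hU => ?_⟩
  rw [he _ _ (hU.preimage e.symm.continuous)]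
  have h1 : e ⁻¹' (e.symm ⁻¹' U) = U := by ext; simp
  rw [h1]
  simp

theorem SmoothIso.trans (h : SmoothIso X Y) (h' : SmoothIso Y Z) : SmoothIso X Z := by
  obtain ⟨e, he⟩ := h
  obtain ⟨e', he'⟩ := h'
  refine ⟨e.trans e', fun U f hU => ?_⟩
  rw [he' _ _ hU, he _ _ (hU.preimage e'.continuous)]
  rfl

/-- The pullback of a smooth chart by an isomorphism of smooth spaces is a smooth chart. -/
theorem IsSmoothChart.comp_homeomorph {n : ℕ} {e : X ≃ₜ Y}
    (he : ∀ (U : Set Y) (f : Y → ℝ), IsOpen U →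
      (smoothOn f U ↔ smoothOn (fun x => f (e x)) (e ⁻¹' U)))
    {φ : OpenPartialHomeomorph Y (EuclideanSpace ℝ (Fin n))} (hφ : IsSmoothChart φ) :
    IsSmoothChart (e.transOpenPartialHomeomorph φ) := by
  intro U f hU hUs
  have h1 : IsOpen (e.symm ⁻¹' U) := hU.preimage e.symm.continuous
  have h2 := he (e.symm ⁻¹' U) (fun y => f (e.symm y)) h1
  have h3 : e ⁻¹' (e.symm ⁻¹' U) = U := by ext; simp
  rw [h3] at h2
  simp only [Homeomorph.symm_apply_apply] at h2
  rw [← h2, hφ _ _ h1]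
  · have h4 : (e.transOpenPartialHomeomorph φ) '' U = φ '' (e.symm ⁻¹' U) := by
      rw [← e.image_eq_preimage_symm, Set.image_image]
      rfl
    rw [h4]
    rfl
  · intro y hy
    have := hUs hy
    simpa using this

theorem IsSmoothManifold.of_smoothIso {n : ℕ} (hY : IsSmoothManifold n Y)
    (h : SmoothIso X Y) : IsSmoothManifold n X := by
  obtain ⟨e, he⟩ := h
  have := hY.t2
  have := hY.secondCountable
  refine ⟨e.symm.t2Space, e.isEmbedding.secondCountableTopology, fun x => ?_⟩
  obtain ⟨φ, hφ, hx⟩ := hY.exists_chart (e x)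
  exact ⟨_, hφ.comp_homeomorph he, hx⟩

/-- The transition map between two smooth charts is smooth. -/
theorem IsSmoothChart.contDiffOn_transition {n : ℕ}
    {φ ψ : OpenPartialHomeomorph X (EuclideanSpace ℝ (Fin n))}
    (hφ : IsSmoothChart φ) (hψ : IsSmoothChart ψ) :
    ContDiffOn ℝ ∞ (fun y => ψ (φ.symm y)) (φ.symm ≫ₕ ψ).source := by
  rw [contDiffOn_euclidean]
  intro i
  have hopen : IsOpen (φ.source ∩ ψ.source) := φ.open_source.inter ψ.open_source
  -- The coordinates of `ψ` are smooth on `X`, being linear when read in `ψ`; reading them in `φ`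
  -- gives the components of the transition map.
  have h1 : smoothOn (fun x => (ψ x) i) (φ.source ∩ ψ.source) := by
    rw [hψ _ _ hopen Set.inter_subset_right]
    have h2 : ContDiffOn ℝ ∞ (fun y : EuclideanSpace ℝ (Fin n) => y i)
        (ψ '' (φ.source ∩ ψ.source)) :=
      (EuclideanSpace.proj (𝕜 := ℝ) i).contDiff.contDiffOn
    refine h2.congr ?_
    rintro _ ⟨x, hx, rfl⟩
    simp [ψ.left_inv hx.2]
  rw [hφ _ _ hopen Set.inter_subset_left] at h1
  refine h1.mono ?_
  intro y hy
  simp only [OpenPartialHomeomorph.trans_source, OpenPartialHomeomorph.symm_source,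
    Set.mem_inter_iff, Set.mem_preimage] at hy
  exact ⟨φ.symm y, ⟨φ.map_target hy.1, hy.2⟩, φ.right_inv hy.1⟩

/-- A chart of `Y` pulled back along `e` is a smooth chart of `X`, so `e` in coordinates is a
transition map of `X`. -/
theorem contMDiff_of_smoothOn_comp {n : ℕ} (hX : IsSmoothManifold n X)
    (hY : IsSmoothManifold n Y) (e : X ≃ₜ Y)
    (he : ∀ (U : Set Y) (f : Y → ℝ), IsOpen U →
      (smoothOn f U ↔ smoothOn (fun x => f (e x)) (e ⁻¹' U))) :
    letI := hX.chartedSpace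
    letI := hY.chartedSpace
    ContMDiff (𝓡 n) (𝓡 n) ∞ e := by
  let _ := hX.chartedSpace
  let _ := hY.chartedSpace
  intro x
  rw [contMDiffAt_iff]
  refine ⟨e.continuous.continuousAt, ?_⟩
  have h1 : IsSmoothChart (chartAt (EuclideanSpace ℝ (Fin n)) x) :=
    (hX.exists_chart x).choose_spec.1
  have h2 : IsSmoothChart (chartAt (EuclideanSpace ℝ (Fin n)) (e x)) :=
    (hY.exists_chart (e x)).choose_spec.1
  have h3 := h1.contDiffOn_transition (h2.comp_homeomorph he)
  have h4 : chartAt (EuclideanSpace ℝ (Fin n)) x x ∈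
      ((chartAt (EuclideanSpace ℝ (Fin n)) x).symm ≫ₕ
        e.transOpenPartialHomeomorph (chartAt (EuclideanSpace ℝ (Fin n)) (e x))).source := by
    simp
  have h5 := (h3.contDiffAt
    ((OpenPartialHomeomorph.open_source _).mem_nhds h4)).contDiffWithinAt (s := Set.univ)
  simpa [Function.comp_def] using h5

theorem SmoothIso.areDiffeomorphic {n : ℕ} (h : SmoothIso X Y) (hX : IsSmoothManifold n X) :
    AreDiffeomorphic n X Y := by
  have hY : IsSmoothManifold n Y := hX.of_smoothIso h.symm
  obtain ⟨e, he⟩ := h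
  let _ := hX.chartedSpace
  let _ := hY.chartedSpace
  refine ⟨hX, hY, ⟨⟨e.toEquiv, contMDiff_of_smoothOn_comp hX hY e he,
    contMDiff_of_smoothOn_comp hY hX e.symm fun U f hU => ?_⟩⟩⟩
  rw [he _ _ (hU.preimage e.symm.continuous)]
  have h1 : e ⁻¹' (e.symm ⁻¹' U) = U := by ext; simp
  rw [h1]
  simp

end SmoothIso

/-! ### Smooth maps on subsets of normed spaces -/

section SmoothAt

variable {V V' V'' : Type*} [NormedAddCommGroup V] [NormedSpace ℝ V]
  [NormedAddCommGroup V'] [NormedSpace ℝ V'] [NormedAddCommGroup V''] [NormedSpace ℝ V'']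

/-- A map defined on a subset of a normed space is smooth at a point if it extends, locally
around this point, to a `C^∞` map on an open subset of the ambient space. -/
def SmoothAt {S : Set V} (f : S → V') (x : S) : Prop :=
  ∃ (W : Set V) (F : V → V'), IsOpen W ∧ (x : V) ∈ W ∧ ContDiffOn ℝ ∞ F W ∧
    ∀ y : S, (y : V) ∈ W → f y = F y

variable {S : Set V} {S' : Set V'}

theorem SmoothAt.continuousAt {f : S → V'} {x : S} (h : SmoothAt f x) : ContinuousAt f x := by
  obtain ⟨W, F, hW, hx, hF, h⟩ := h
  have h1 : ContinuousAt (fun y : S => F y) x :=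
    (hF.continuousOn.continuousAt (hW.mem_nhds hx)).comp continuous_subtype_val.continuousAt
  refine h1.congr ?_
  filter_upwards [continuous_subtype_val.continuousAt.preimage_mem_nhds (hW.mem_nhds hx)]
    with y hy using (h y hy).symm

theorem SmoothAt.of_contDiff {F : V → V'} (hF : ContDiff ℝ ∞ F) (x : S) :
    SmoothAt (fun y : S => F y) x :=
  ⟨Set.univ, F, isOpen_univ, trivial, hF.contDiffOn, fun _ _ => rfl⟩

/-- Composition with a map which is only given locally, on the ambient spaces. -/
theorem SmoothAt.of_comp {f : S → V''} {h : S' → V''} {x : S} {x' : S'} {W : Set V}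
    {F : V → V'} (hh : SmoothAt h x') (hW : IsOpen W) (hx : (x : V) ∈ W)
    (hF : ContDiffOn ℝ ∞ F W) (hFx : F x = x')
    (hf : ∀ y : S, (y : V) ∈ W → ∃ hy : F y ∈ S', f y = h ⟨F y, hy⟩) : SmoothAt f x := by
  obtain ⟨W', H, hW', hx', hH, h1⟩ := hh
  refine ⟨W ∩ F ⁻¹' W', H ∘ F, hF.continuousOn.isOpen_inter_preimage hW hW',
    ⟨hx, by rwa [Set.mem_preimage, hFx]⟩,
    hH.comp (hF.mono Set.inter_subset_left) fun y hy => hy.2, fun y hy => ?_⟩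
  obtain ⟨hy', h2⟩ := hf y hy.1
  exact h2.trans (h1 ⟨F y, hy'⟩ hy.2)

theorem SmoothAt.comp {h : S' → V''} {g : S → S'} {x : S} (hh : SmoothAt h (g x))
    (hg : SmoothAt (fun y => (g y : V')) x) : SmoothAt (fun y => h (g y)) x := by
  obtain ⟨W, F, hW, hx, hF, h1⟩ := hg
  refine hh.of_comp hW hx hF (h1 x hx).symm fun y hy => ?_
  rw [← h1 y hy]
  exact ⟨(g y).2, rfl⟩

theorem continuous_of_smoothAt {g : S → S'} (hg : ∀ x, SmoothAt (fun y => (g y : V')) x) :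
    Continuous g :=
  Continuous.subtype_mk (f := fun y => (g y : V'))
    (continuous_iff_continuousAt.2 fun x => (hg x).continuousAt) _

/-- For real functions on a subset, `smoothOn` unfolds to `SmoothAt` at each point of the open set.
-/
theorem smoothOn_comp {g : S → S'} (hg : ∀ x, SmoothAt (fun y => (g y : V')) x)
    {h : S' → ℝ} {U : Set S'} (hh : smoothOn h U) :
    smoothOn (fun x => h (g x)) (g ⁻¹' U) :=
  fun x hx => SmoothAt.comp (hh _ hx) (hg x)

end SmoothAt

/-! ### Equivariant diffeomorphisms -/

section Equivariant

theorem orbitSetoid_iff {d : ℕ} [NeZero d] {V : Type*} [MulAction (axisRotations d) V]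
    {S : Set V} {x y : S} :
    (orbitSetoid d S) x y ↔ ∃ R : axisRotations d, R • (y : V) = x := Iff.rfl

variable {d : ℕ} [NeZero d] {V V' V'' : Type*}
  [NormedAddCommGroup V] [NormedSpace ℝ V] [MulAction (axisRotations d) V]
  [NormedAddCommGroup V'] [NormedSpace ℝ V'] [MulAction (axisRotations d) V']
  [NormedAddCommGroup V''] [NormedSpace ℝ V''] [MulAction (axisRotations d) V'']

/-- Two subsets of spaces with an action of `SO(d-1)` are equivariantly diffeomorphic. -/
def EquivariantDiffeo (S : Set V) (S' : Set V') : Prop :=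
  ∃ (f : S → S') (g : S' → S), (∀ x, SmoothAt (fun y => (f y : V')) x) ∧
    (∀ x, SmoothAt (fun y => (g y : V)) x) ∧ (∀ x, g (f x) = x) ∧ (∀ x, f (g x) = x) ∧
    -- Equivariance is expressed through pairs of points already in the subset, so no invariance of
    -- `S` or `S'` has to be supplied.
    (∀ (R : axisRotations d) (x y : S), (y : V) = R • (x : V) → (f y : V') = R • (f x : V')) ∧
    (∀ (R : axisRotations d) (x y : S'), (y : V') = R • (x : V') → (g y : V) = R • (g x : V))

variable {S : Set V} {S' : Set V'} {S'' : Set V''}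

theorem EquivariantDiffeo.symm (h : EquivariantDiffeo (d := d) S S') :
    EquivariantDiffeo (d := d) S' S := by
  obtain ⟨f, g, hf, hg, hgf, hfg, hfR, hgR⟩ := h
  exact ⟨g, f, hg, hf, hfg, hgf, hgR, hfR⟩

theorem EquivariantDiffeo.trans (h : EquivariantDiffeo (d := d) S S')
    (h' : EquivariantDiffeo (d := d) S' S'') : EquivariantDiffeo (d := d) S S'' := by
  obtain ⟨f, g, hf, hg, hgf, hfg, hfR, hgR⟩ := h
  obtain ⟨f', g', hf', hg', hgf', hfg', hfR', hgR'⟩ := h'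
  exact ⟨f' ∘ f, g ∘ g', fun x => SmoothAt.comp (g := f) (hf' (f x)) (hf x),
    fun x => SmoothAt.comp (g := g') (hg (g' x)) (hg' x), fun x => by simp [hgf', hgf],
    fun x => by simp [hfg', hfg], fun R x y hxy => hfR' R _ _ (hfR R _ _ hxy),
    fun R x y hxy => hgR R _ _ (hgR' R _ _ hxy)⟩

/-- The quotients of equivariantly diffeomorphic spaces are isomorphic. -/
theorem EquivariantDiffeo.smoothIso (h : EquivariantDiffeo (d := d) S S') :
    SmoothIso (Quotient (orbitSetoid d S)) (Quotient (orbitSetoid d S')) := by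
  obtain ⟨f, g, hf, hg, hgf, hfg, hfR, hgR⟩ := h
  have hf' : ∀ x y : S, (orbitSetoid d S) x y → (orbitSetoid d S') (f x) (f y) := by
    rintro x y ⟨R, hR⟩
    exact ⟨R, (hfR R _ _ hR.symm).symm⟩
  have hg' : ∀ x y : S', (orbitSetoid d S') x y → (orbitSetoid d S) (g x) (g y) := by
    rintro x y ⟨R, hR⟩
    exact ⟨R, (hgR R _ _ hR.symm).symm⟩
  let e : Quotient (orbitSetoid d S) ≃ₜ Quotient (orbitSetoid d S') :=
    { toFun := Quotient.map f hf'
      invFun := Quotient.map g hg'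
      left_inv := by
        intro x
        induction x using Quotient.inductionOn with
        | h x => simp [hgf]
      right_inv := by
        intro x
        induction x using Quotient.inductionOn with
        | h x => simp [hfg]
      continuous_toFun := (continuous_of_smoothAt hf).quotient_map' hf'
      continuous_invFun := (continuous_of_smoothAt hg).quotient_map' hg' }
  refine ⟨e, fun U u hU => ⟨fun hu => ?_, fun hu => ?_⟩⟩
  · exact smoothOn_comp hf (h := fun x => u (Quotient.mk _ x)) hu
  -- Pulling back further along `g` recovers `u`, since `e` maps the class of `g x` to the class of
  -- `x`.
  · have h1 := smoothOn_comp hg (h := fun x => u (e (Quotient.mk _ x))) hu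
    have h2 : ∀ x, e (Quotient.mk _ (g x)) = Quotient.mk _ x := fun x =>
      congrArg (Quotient.mk _) (hfg x)
    have h3 : g ⁻¹' (Quotient.mk (orbitSetoid d S) ⁻¹' (e ⁻¹' U)) =
        Quotient.mk (orbitSetoid d S') ⁻¹' U := by
      ext x
      simp only [Set.mem_preimage, h2]
    simp only [h2] at h1
    change smoothOn _ (Quotient.mk (orbitSetoid d S') ⁻¹' U)
    rw [← h3]
    exact h1

end Equivariant

/-! ### Chambers and signs -/

/-- The end of the lined chain with the directions `ε`, relative to the prescribed end. -/
def linedSum {n : ℕ} (ε : Fin n → ℝ) (a : Fin (n + 1) → ℝ) : ℝ :=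
  ∑ i, a i.castSucc * ε i - a (Fin.last n)

/-- The length vectors, possibly with edges of length zero, for which there is no lined chain. -/
def weaklyGeneric (n : ℕ) : Set (Fin (n + 1) → ℝ) :=
  {a | (∀ i, 0 ≤ a i) ∧ 0 < a (Fin.last n) ∧
    ∀ ε : Fin n → ℝ, (∀ i, ε i = 1 ∨ ε i = -1) → linedSum ε a ≠ 0}

theorem continuous_linedSum {n : ℕ} (ε : Fin n → ℝ) : Continuous (linedSum ε) := by
  unfold linedSum
  fun_prop

/-- If the sum vanished, the vectors `ε i • e₁ 1` would form a lined chain. -/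
theorem linedSum_ne_zero {n : ℕ} {a : Fin (n + 1) → ℝ} (ha : chains 1 a = ∅) {ε : Fin n → ℝ}
    (hε : ∀ i, ε i = 1 ∨ ε i = -1) : linedSum ε a ≠ 0 := by
  intro h
  have h1 : (fun i => ε i • e₁ 1) ∈ chains 1 a := by
    refine ⟨fun i => ?_, ?_⟩
    · rcases hε i with h | h <;> simp [h, e₁]
    · simp only [smul_smul, ← Finset.sum_smul]
      congr 1
      unfold linedSum at h
      linarith
  rw [ha] at h1
  exact h1

theorem genericOrdered_subset (n : ℕ) : genericOrdered n ⊆ weaklyGeneric n :=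
  fun _ ha => ⟨fun i => (ha.1 i).le, ha.1 _, fun _ hε => linedSum_ne_zero ha.2.2 hε⟩

/-- The lined sum is continuous and has no zero on `weaklyGeneric`, so the intermediate value
theorem forbids a change of sign. -/
theorem linedSum_pos_of_isPreconnected {n : ℕ} {K : Set (Fin (n + 1) → ℝ)}
    (hK : IsPreconnected K) (hK' : K ⊆ weaklyGeneric n) {x y : Fin (n + 1) → ℝ}
    (hx : x ∈ K) (hy : y ∈ K) {ε : Fin n → ℝ} (hε : ∀ i, ε i = 1 ∨ ε i = -1)
    (h : 0 < linedSum ε x) : 0 < linedSum ε y := by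
  by_contra h1
  obtain ⟨z, hz, h2⟩ := hK.intermediate_value hy hx (continuous_linedSum ε).continuousOn
    ⟨not_lt.1 h1, h.le⟩
  exact (hK' hz).2.2 ε hε h2

theorem linedSum_pos_of_mem_chamberOf {n : ℕ} {c x y : Fin (n + 1) → ℝ}
    (hx : x ∈ chamberOf c) (hy : y ∈ chamberOf c) {ε : Fin n → ℝ}
    (hε : ∀ i, ε i = 1 ∨ ε i = -1) (h : 0 < linedSum ε x) : 0 < linedSum ε y :=
  linedSum_pos_of_isPreconnected isPreconnected_connectedComponentIn
    ((connectedComponentIn_subset _ _).trans (genericOrdered_subset n)) hx hy hε h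

theorem linedSum_cons {n : ℕ} (ε : Fin (n + 1) → ℝ) (δ : ℝ) (b : Fin (n + 1) → ℝ) :
    linedSum ε (Fin.cons δ b : Fin (n + 2) → ℝ) = δ * ε 0 + linedSum (fun i => ε i.succ) b := by
  unfold linedSum
  rw [Fin.sum_univ_succ, ← Fin.succ_last]
  simp only [Fin.castSucc_zero, Fin.cons_zero, ← Fin.succ_castSucc, Fin.cons_succ]
  ring

/-- A zero edge does not change any lined sum. This degenerate vector is the endpoint of the
deformation, and the reason for allowing zero lengths. -/
theorem cons_zero_mem_weaklyGeneric {n : ℕ} {b : Fin (n + 1) → ℝ} (hb : b ∈ weaklyGeneric n) :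
    (Fin.cons 0 b : Fin (n + 2) → ℝ) ∈ weaklyGeneric (n + 1) := by
  refine ⟨fun i => ?_, ?_, fun ε hε => ?_⟩
  · refine Fin.cases ?_ (fun j => ?_) i
    · simp
    · simpa using hb.1 j
  · rw [← Fin.succ_last]
    simpa using hb.2.1
  · rw [linedSum_cons, zero_mul, zero_add]
    exact hb.2.2 _ fun i => hε _

/-- An element of `α⁺` has the same signs as the elements of `α`, with a zero edge added. -/
theorem linedSum_pos_iff_of_mem_plusChamber {n : ℕ} {α : Set (Fin (n + 1) → ℝ)}
    (hα : IsChamber α) {b : Fin (n + 1) → ℝ} (hb : b ∈ α) {a : Fin (n + 2) → ℝ}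
    (ha : a ∈ plusChamber α) {ε : Fin (n + 1) → ℝ} (hε : ∀ i, ε i = 1 ∨ ε i = -1) :
    0 < linedSum ε (Fin.cons 0 b : Fin (n + 2) → ℝ) ↔ 0 < linedSum ε a := by
  obtain ⟨c, -, rfl⟩ := hα
  obtain ⟨b', hb', r, hr, h⟩ := ha
  have hε' : ∀ i : Fin n, ε i.succ = 1 ∨ ε i.succ = -1 := fun i => hε _
  have h1 : 0 < linedSum (fun i => ε i.succ) b ↔ 0 < linedSum (fun i => ε i.succ) b' :=
    ⟨linedSum_pos_of_mem_chamberOf hb hb' hε', linedSum_pos_of_mem_chamberOf hb' hb hε'⟩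
  rw [linedSum_cons, zero_mul, zero_add, h1]
  have h2 : linedSum (fun i => ε i.succ) b' ≠ 0 :=
    (genericOrdered_subset n (connectedComponentIn_subset _ _ hb')).2.2 _ hε'
  set s := linedSum (fun i => ε i.succ) b'
  have h3 : 0 < |s| := abs_pos.2 h2
  -- Small enough to be admissible in `plusChamber`, and too small for `± δ` to change the sign of
  -- `s`.
  set δ := min r (|s| / 2)
  have hδ : δ ∈ Set.Ioc 0 r := ⟨lt_min hr (by linarith), min_le_left _ _⟩
  have hδ' : δ ≤ |s| / 2 := min_le_right _ _
  obtain ⟨h4, h5⟩ := h δ hδ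
  have h6 : (Fin.cons δ b' : Fin (n + 2) → ℝ) ∈ chamberOf (Fin.cons δ b' : Fin (n + 2) → ℝ) :=
    mem_connectedComponentIn h4
  have h7 : 0 < linedSum ε (Fin.cons δ b' : Fin (n + 2) → ℝ) ↔ 0 < linedSum ε a :=
    ⟨linedSum_pos_of_mem_chamberOf h6 h5 hε, linedSum_pos_of_mem_chamberOf h5 h6 hε⟩
  rw [← h7, linedSum_cons]
  have hδ0 := hδ.1
  change 0 < s ↔ 0 < δ * ε 0 + s
  rcases lt_or_gt_of_ne h2 with hs | hs
  · rw [abs_of_neg hs] at hδ'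
    rcases hε 0 with h | h <;> rw [h] <;> constructor <;> intro <;> linarith
  · rw [abs_of_pos hs] at hδ'
    rcases hε 0 with h | h <;> rw [h] <;> constructor <;> intro <;> linarith

theorem linedSum_combo {n : ℕ} (ε : Fin n → ℝ) (a b : Fin (n + 1) → ℝ) (s t : ℝ) :
    linedSum ε (s • a + t • b) = s * linedSum ε a + t * linedSum ε b := by
  simp only [linedSum, Pi.add_apply, Pi.smul_apply, smul_eq_mul, add_mul, Finset.sum_add_distrib,
    mul_sub, Finset.mul_sum, mul_assoc]
  ring

/-- Lined sums are linear in the lengths. At both ends each of them lies in the same open half-line,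
which is convex. -/
theorem segment_subset_weaklyGeneric {n : ℕ} {x y : Fin (n + 1) → ℝ}
    (hx : x ∈ weaklyGeneric n) (hy : y ∈ weaklyGeneric n)
    (h : ∀ ε : Fin n → ℝ, (∀ i, ε i = 1 ∨ ε i = -1) → (0 < linedSum ε x ↔ 0 < linedSum ε y)) :
    segment ℝ x y ⊆ weaklyGeneric n := by
  rintro _ ⟨s, t, hs, ht, hst, rfl⟩
  refine ⟨fun i => ?_, ?_, fun ε hε => ?_⟩
  · have h1 := hx.1 i
    have h2 := hy.1 i
    simp only [Pi.add_apply, Pi.smul_apply, smul_eq_mul]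
    positivity
  · have h1 := convex_Ioi (0 : ℝ) hx.2.1 hy.2.1 hs ht hst
    simpa using h1
  · rw [linedSum_combo]
    have h1 := hx.2.2 ε hε
    have h2 := hy.2.2 ε hε
    have h3 := h ε hε
    rcases lt_or_gt_of_ne h1 with h4 | h4
    · have h5 : linedSum ε y < 0 := lt_of_le_of_ne (not_lt.1 fun h6 => by
        have := h3.2 h6
        linarith) h2
      have := convex_Iio (0 : ℝ) h4 h5 hs ht hst
      simp only [smul_eq_mul, Set.mem_Iio] at this
      exact this.ne
    · have := convex_Ioi (0 : ℝ) h4 (h3.1 h4) hs ht hst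
      simp only [smul_eq_mul, Set.mem_Ioi] at this
      exact this.ne'

theorem mem_genericOrdered_of_mem_plusChamber {n : ℕ} {α : Set (Fin (n + 1) → ℝ)}
    {a : Fin (n + 2) → ℝ} (ha : a ∈ plusChamber α) : a ∈ genericOrdered (n + 1) := by
  obtain ⟨b, -, r, hr, h⟩ := ha
  exact connectedComponentIn_subset _ _ (h r ⟨hr, le_rfl⟩).2

theorem mem_genericOrdered_of_isChamber {n : ℕ} {α : Set (Fin (n + 1) → ℝ)}
    (hα : IsChamber α) {b : Fin (n + 1) → ℝ} (hb : b ∈ α) : b ∈ genericOrdered n := by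
  obtain ⟨c, -, rfl⟩ := hα
  exact connectedComponentIn_subset _ _ hb

/-! ### Smooth inverse and implicit functions on open sets -/

section Inverse

variable {E F P : Type*} [NormedAddCommGroup E] [NormedSpace ℝ E] [CompleteSpace E]
  [NormedAddCommGroup F] [NormedSpace ℝ F] [NormedAddCommGroup P] [NormedSpace ℝ P]
  [CompleteSpace P]

/-- The inverse function theorem: a smooth map is a diffeomorphism between neighbourhoods
around each point where its derivative is invertible. -/
theorem exists_smooth_inverse {f : E → F} {U : Set E} (hU : IsOpen U)
    (hf : ContDiffOn ℝ ∞ f U) {x : E} (hx : x ∈ U) {f' : E ≃L[ℝ] F}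
    (hf' : HasFDerivAt f (f' : E →L[ℝ] F) x) :
    ∃ e : OpenPartialHomeomorph E F, x ∈ e.source ∧ e.source ⊆ U ∧ (∀ y, e y = f y) ∧
      ContDiffOn ℝ ∞ e.symm e.target := by
  have hfx : ContDiffAt ℝ ∞ f x := hf.contDiffAt (hU.mem_nhds hx)
  have hn : (∞ : WithTop ℕ∞) ≠ 0 := by simp
  let e := hfx.toOpenPartialHomeomorph f hf' hn
  -- Invertibility of the derivative is an open condition; imposing it on the whole source makes the
  -- inverse smooth on the whole target, not only at one point.
  let s : Set E := U ∩ fderiv ℝ f ⁻¹' Set.range ((↑) : (E ≃L[ℝ] F) → E →L[ℝ] F)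
  have hs : IsOpen s := (hf.continuousOn_fderiv_of_isOpen hU (by simp)).isOpen_inter_preimage hU
    ContinuousLinearEquiv.isOpen
  refine ⟨e.restrOpen s hs, ⟨hfx.mem_toOpenPartialHomeomorph_source hf' hn, hx, f', ?_⟩,
    fun y hy => hy.2.1, fun y => rfl, fun y hy => ?_⟩
  · exact hf'.fderiv.symm
  · have h1 := (e.restrOpen s hs).map_target hy
    obtain ⟨h2, g, hg⟩ := h1.2
    have h3 : ContDiffAt ℝ ∞ f ((e.restrOpen s hs).symm y) := hf.contDiffAt (hU.mem_nhds h2)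
    refine ((e.restrOpen s hs).contDiffAt_symm (f₀' := g) hy ?_ h3).contDiffWithinAt
    rw [hg]
    exact (h3.differentiableAt hn).hasFDerivAt

/-- The implicit function theorem, with a solution which is smooth on an open set. -/
theorem exists_smooth_implicit {f : P × E → F} {D : Set (P × E)} (hD : IsOpen D)
    (hf : ContDiffOn ℝ ∞ f D) {p₀ : P} {w₀ : E} (h₀ : (p₀, w₀) ∈ D) (hf₀ : f (p₀, w₀) = 0)
    {M : E ≃L[ℝ] F} (hM : HasFDerivAt (fun w => f (p₀, w)) (M : E →L[ℝ] F) w₀) :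
    ∃ (Q : Set P) (W : P → E), IsOpen Q ∧ p₀ ∈ Q ∧ ContDiffOn ℝ ∞ W Q ∧ W p₀ = w₀ ∧
      (∀ p ∈ Q, f (p, W p) = 0) ∧ ∃ O ∈ 𝓝 (p₀, w₀), ∀ p w w', (p, w) ∈ O → (p, w') ∈ O →
        f (p, w) = 0 → f (p, w') = 0 → w = w' := by
  have hd : HasFDerivAt f (fderiv ℝ f (p₀, w₀)) (p₀, w₀) :=
    ((hf.contDiffAt (hD.mem_nhds h₀)).differentiableAt (by simp)).hasFDerivAt
  set f' := fderiv ℝ f (p₀, w₀)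
  have h1 : f'.comp (ContinuousLinearMap.inr ℝ P E) = M :=
    (hd.comp w₀ (hasFDerivAt_prodMk_right p₀ w₀)).unique hM
  have h2 : ∀ p w, f' (p, w) = f' (p, 0) + M w := by
    intro p w
    have h3 : f' (0, w) = M w := by rw [← ContinuousLinearEquiv.coe_coe, ← h1]; rfl
    rw [← h3, ← map_add]
    simp
  -- The derivative of `(p, w) ↦ (p, f (p, w))` is block triangular, with inverse `(p, q) ↦ (p, M⁻¹
  -- (q - f' (p, 0)))`.
  let L : (P × E) ≃L[ℝ] (P × F) := ContinuousLinearEquiv.equivOfInverse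
    ((ContinuousLinearMap.fst ℝ P E).prod f')
    ((ContinuousLinearMap.fst ℝ P F).prod ((M.symm : F →L[ℝ] E).comp
      (ContinuousLinearMap.snd ℝ P F -
        (f'.comp (ContinuousLinearMap.inl ℝ P E)).comp (ContinuousLinearMap.fst ℝ P F))))
    (fun ⟨p, w⟩ => by simp [h2 p w])
    (fun ⟨p, w⟩ => by
      simp only [ContinuousLinearMap.prod_apply, ContinuousLinearMap.coe_fst', Prod.mk.injEq,
        true_and]
      rw [h2]
      simp)
  have hL : HasFDerivAt (fun q : P × E => (q.1, f q)) (L : (P × E) →L[ℝ] (P × F)) (p₀, w₀) :=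
    (hasFDerivAt_fst (p := (p₀, w₀))).prodMk hd
  obtain ⟨e, he₀, heD, he, hes⟩ := exists_smooth_inverse hD (contDiffOn_fst.prodMk hf) h₀ hL
  have hc : ContDiff ℝ ∞ fun p : P => (p, (0 : F)) := contDiff_id.prodMk contDiff_const
  have hz : e (p₀, w₀) = (p₀, 0) := by rw [he, hf₀]
  -- The solution is the second component of the local inverse at `(p, 0)`; uniqueness is
  -- injectivity of `e` on its source.
  refine ⟨(fun p : P => (p, (0 : F))) ⁻¹' e.target, fun p => (e.symm (p, 0)).2,
    e.open_target.preimage hc.continuous, ?_, ?_, ?_, fun p hp => ?_,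
    e.source, e.open_source.mem_nhds he₀, fun p w w' hw hw' h h' => ?_⟩
  · change (p₀, (0 : F)) ∈ e.target
    rw [← hz]
    exact e.map_source he₀
  · exact contDiff_snd.comp_contDiffOn (hes.comp hc.contDiffOn fun p hp => hp)
  · change (e.symm (p₀, 0)).2 = w₀
    rw [← hz, e.left_inv he₀]
  · have h3 := e.right_inv hp
    rw [he] at h3
    have h4 : (e.symm (p, 0)).1 = p := congrArg Prod.fst h3
    have h5 : f (e.symm (p, 0)) = 0 := congrArg Prod.snd h3
    have h6 : (p, (e.symm (p, 0)).2) = e.symm (p, 0) := Prod.ext h4.symm rfl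
    rw [h6, h5]
  · have h3 : e (p, w) = e (p, w') := by rw [he, he, h, h']
    exact congrArg Prod.snd (e.injOn hw hw' h3)

end Inverse

/-! ### Conformal translations of the sphere -/

section Boost

theorem add_ne_zero_of_norm {E : Type*} [NormedAddCommGroup E] {a x : E} (hx : ‖x‖ = 1)
    (ha : ‖a‖ < 1) : x + a ≠ 0 := by
  intro h
  rw [eq_neg_of_add_eq_zero_left h, norm_neg] at hx
  exact ha.ne hx

variable {E : Type*} [NormedAddCommGroup E] [InnerProductSpace ℝ E]

/-- The conformal map of the sphere which is the restriction of the hyperbolic translation of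
the unit ball moving `0` to `a`. -/
def boost (a x : E) : E := a + ((1 - ‖a‖ ^ 2) / ‖x + a‖ ^ 2) • (x + a)

theorem boost_zero {x : E} (hx : ‖x‖ = 1) : boost 0 x = x := by
  simp [boost, hx]

theorem boost_sub (a x : E) : boost a x + -a = ((1 - ‖a‖ ^ 2) / ‖x + a‖ ^ 2) • (x + a) := by
  simp [boost]

/-- The vector `boost a x - a` is a multiple of `x + a`, so the second map rescales it back to `x +
a` before subtracting `a`. -/
theorem boost_neg_boost {a x : E} (hx : ‖x‖ = 1) (ha : ‖a‖ < 1) :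
    boost (-a) (boost a x) = x := by
  have h1 : ‖x + a‖ ^ 2 ≠ 0 := by simpa using add_ne_zero_of_norm hx ha
  have h2 : 1 - ‖a‖ ^ 2 ≠ 0 := by nlinarith [norm_nonneg a]
  rw [boost, boost_sub, smul_smul, norm_smul, mul_pow, Real.norm_eq_abs, sq_abs, norm_neg]
  have h3 : (1 - ‖a‖ ^ 2) / (((1 - ‖a‖ ^ 2) / ‖x + a‖ ^ 2) ^ 2 * ‖x + a‖ ^ 2) *
      ((1 - ‖a‖ ^ 2) / ‖x + a‖ ^ 2) = 1 := by
    generalize ‖x + a‖ ^ 2 = s at *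
    field_simp
  rw [h3]
  simp

theorem norm_boost {a x : E} (hx : ‖x‖ = 1) (ha : ‖a‖ < 1) : ‖boost a x‖ = 1 := by
  have h1 : ‖x + a‖ ^ 2 ≠ 0 := by simpa using add_ne_zero_of_norm hx ha
  have h2 : ‖x + a‖ ^ 2 = 1 + 2 * inner ℝ x a + ‖a‖ ^ 2 := by
    rw [norm_add_sq_real, hx]; ring
  have h3 : inner ℝ a (x + a) = inner ℝ x a + ‖a‖ ^ 2 := by
    rw [inner_add_right, real_inner_self_eq_norm_sq, real_inner_comm]
  have h4 : ‖boost a x‖ ^ 2 = 1 := by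
    rw [boost, norm_add_sq_real, norm_smul, mul_pow, inner_smul_right, h3, Real.norm_eq_abs,
      sq_abs]
    generalize ‖x + a‖ ^ 2 = s at *
    field_simp
    rw [show inner ℝ x a = (s - 1 - ‖a‖ ^ 2) / 2 by linarith]
    ring
  exact (sq_eq_sq₀ (norm_nonneg _) zero_le_one).1 (by simpa using h4)

/-- Only norms and linear operations enter the formula, so linear isometries commute with it.
Equivariance of the deformations rests on this. -/
theorem boost_map {R : E →ₗ[ℝ] E} (hR : ∀ x, ‖R x‖ = ‖x‖) (a x : E) :
    boost (R a) (R x) = R (boost a x) := by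
  rw [boost, boost, ← map_add, hR, hR, map_add R a, map_smul]

theorem contDiffOn_boost :
    ContDiffOn ℝ ∞ (fun p : E × E => boost p.1 p.2) {p | p.2 + p.1 ≠ 0} := by
  unfold boost
  have h1 : ContDiff ℝ ∞ fun p : E × E => p.2 + p.1 := contDiff_snd.add contDiff_fst
  refine contDiff_fst.contDiffOn.add (ContDiffOn.smul (ContDiffOn.div ?_ ?_ ?_) h1.contDiffOn)
  · exact (contDiff_const.sub (contDiff_fst.norm_sq ℝ)).contDiffOn
  · exact (h1.norm_sq ℝ).contDiffOn
  · intro p hp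
    simpa using hp

/-- The derivative of `boost a x` with respect to `a`, at `a = 0`. -/
theorem hasFDerivAt_boost {x : E} (hx : ‖x‖ = 1) :
    HasFDerivAt (fun a => boost a x)
      ((2 : ℝ) • (ContinuousLinearMap.id ℝ E - (innerSL ℝ x).smulRight x)) 0 := by
  have h1 : HasFDerivAt (fun a : E => x + a) (ContinuousLinearMap.id ℝ E) 0 :=
    (hasFDerivAt_id _).const_add x
  have h2 := (hasFDerivAt_id (𝕜 := ℝ) (0 : E)).norm_sq
  have h3 := h1.norm_sq
  have h4 : ‖x + 0‖ ^ 2 ≠ 0 := by simp [hx]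
  have h5 : HasFDerivAt (fun a : E => (‖x + a‖ ^ 2)⁻¹) _ 0 :=
    (hasDerivAt_inv h4).comp_hasFDerivAt (0 : E) h3
  have h6 := (hasFDerivAt_id (𝕜 := ℝ) (0 : E)).add (((h2.const_sub 1).mul h5).smul h1)
  convert! h6 using 1
  ext v
  simp [hx]
  module

end Boost

/-! ### Perturbation of the lengths -/

section Perturbation

variable {n : ℕ}

/-- The failure of the chain `z`, translated by `w`, to be a chain for the lengths `c`. -/
def chainDefect (q : ((Fin (n + 1) → ℝ) × (Fin n → EuclideanSpace ℝ (Fin 3))) ×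
    EuclideanSpace ℝ (Fin 3)) : EuclideanSpace ℝ (Fin 3) :=
  ∑ i, q.1.1 i.castSucc • boost q.2 (q.1.2 i) - q.1.1 (Fin.last n) • e₁ 3

theorem mem_chains_iff {c : Fin (n + 1) → ℝ} {z : Fin n → EuclideanSpace ℝ (Fin 3)} :
    z ∈ chains 3 c ↔ (∀ i, ‖z i‖ = 1) ∧ chainDefect ((c, z), 0) = 0 := by
  refine and_congr_right fun h => ?_
  simp only [chainDefect, boost_zero (h _), sub_eq_zero]

theorem boost_mem_chains {c : Fin (n + 1) → ℝ} {z : Fin n → EuclideanSpace ℝ (Fin 3)}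
    (hz : ∀ i, ‖z i‖ = 1) {w : EuclideanSpace ℝ (Fin 3)} (hw : ‖w‖ < 1)
    (h : chainDefect ((c, z), w) = 0) : (fun i => boost w (z i)) ∈ chains 3 c :=
  ⟨fun i => norm_boost (hz i) hw, sub_eq_zero.1 h⟩

theorem contDiffOn_chainDefect : ContDiffOn ℝ ∞ (chainDefect (n := n))
    {q | ∀ i, q.1.2 i + q.2 ≠ 0} := by
  unfold chainDefect
  refine ContDiffOn.sub (ContDiffOn.sum fun i _ => ContDiffOn.fun_smul ?_ ?_) ?_
  · exact ContDiff.contDiffOn (by fun_prop)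
  · have h1 : ContDiff ℝ ∞ fun q : ((Fin (n + 1) → ℝ) × (Fin n → EuclideanSpace ℝ (Fin 3))) ×
        EuclideanSpace ℝ (Fin 3) => (q.2, q.1.2 i) := by fun_prop
    exact contDiffOn_boost.comp h1.contDiffOn fun q hq => hq i
  · exact ContDiff.contDiffOn (by fun_prop)

theorem isOpen_add_ne_zero : IsOpen {q : ((Fin (n + 1) → ℝ) ×
    (Fin n → EuclideanSpace ℝ (Fin 3))) × EuclideanSpace ℝ (Fin 3) |
      ∀ i, q.1.2 i + q.2 ≠ 0} := by
  simp only [Set.ofPred_forall]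
  exact isOpen_iInter_of_finite fun i => isOpen_ne_fun (by fun_prop) continuous_const

theorem smul_e₁ (R : axisRotations 3) : R • e₁ 3 = e₁ 3 := R.2.2.2

/-- Boosts commute with isometries, and the prescribed end is a multiple of the fixed vector `e₁ 3`.
-/
theorem chainDefect_smul (R : axisRotations 3) (c : Fin (n + 1) → ℝ)
    (z : Fin n → EuclideanSpace ℝ (Fin 3)) (w : EuclideanSpace ℝ (Fin 3)) :
    chainDefect ((c, R • z), R • w) = R • chainDefect ((c, z), w) := by
  have h1 : ∀ x, boost (R • w) (R • x) = R • boost w x := fun x =>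
    boost_map (R := (R : EuclideanSpace ℝ (Fin 3) ≃ₗ[ℝ] EuclideanSpace ℝ (Fin 3)).toLinearMap)
      R.2.1 w x
  have h2 : ∀ x : EuclideanSpace ℝ (Fin 3), R • x =
      (R : EuclideanSpace ℝ (Fin 3) ≃ₗ[ℝ] EuclideanSpace ℝ (Fin 3)) x := fun _ => rfl
  simp only [chainDefect, Pi.smul_apply, h1]
  conv_lhs => rw [← smul_e₁ R]
  simp only [h2, map_sub, map_sum, map_smul]

theorem norm_e₁ (d : ℕ) [NeZero d] : ‖e₁ d‖ = 1 := by simp [e₁]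

theorem norm_smul_rotation (R : axisRotations 3) (x : EuclideanSpace ℝ (Fin 3)) :
    ‖R • x‖ = ‖x‖ := R.2.1 x

/-- The equality case of Cauchy–Schwarz: the component of `x` orthogonal to `u` has square norm `1 -
⟪x, u⟫ ^ 2`. -/
theorem eq_inner_smul_of_sq_eq_one {x u : EuclideanSpace ℝ (Fin 3)} (hx : ‖x‖ = 1)
    (hu : ‖u‖ = 1) (h : inner ℝ x u ^ 2 = (1 : ℝ)) : x = (inner ℝ x u : ℝ) • u := by
  have h1 : ‖x - (inner ℝ x u : ℝ) • u‖ ^ 2 = 0 := by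
    rw [norm_sub_sq_real, norm_smul, mul_pow, inner_smul_right, Real.norm_eq_abs, sq_abs, hx, hu]
    linear_combination -h
  have h2 := pow_eq_zero_iff (two_ne_zero) |>.1 h1
  exact sub_eq_zero.1 (norm_eq_zero.1 h2)

/-- The edges of positive length of a chain with generic lengths are not collinear. -/
theorem eq_zero_of_sum_projection_eq_zero {c : Fin (n + 1) → ℝ} (hc : c ∈ weaklyGeneric n)
    {z : Fin n → EuclideanSpace ℝ (Fin 3)} (hz : z ∈ chains 3 c) {u : EuclideanSpace ℝ (Fin 3)}
    (h : ∑ i, c i.castSucc • (u - (inner ℝ (z i) u : ℝ) • z i) = 0) : u = 0 := by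
  by_contra hu
  have hu' : ‖u‖ ≠ 0 := norm_ne_zero_iff.2 hu
  -- Pairing the hypothesis with `u` gives a vanishing sum of nonnegative terms, so each edge of
  -- positive length is parallel to `u`.
  have h1 : ∑ i, c i.castSucc * (‖u‖ ^ 2 - inner ℝ (z i) u ^ 2) = 0 := by
    have h2 := congrArg (fun x => (inner ℝ u x : ℝ)) h
    simp only [inner_sum, inner_smul_right, inner_sub_right, inner_zero_right,
      real_inner_self_eq_norm_sq] at h2
    rw [← h2]
    refine Finset.sum_congr rfl fun i _ => ?_
    rw [real_inner_comm u (z i)]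
    ring
  have h2 : ∀ i, inner ℝ (z i) u ^ 2 ≤ ‖u‖ ^ 2 := fun i => by
    have h3 := abs_real_inner_le_norm (z i) u
    rw [hz.1 i, one_mul] at h3
    exact sq_le_sq' (by linarith [neg_abs_le (inner ℝ (z i) u : ℝ)])
      ((le_abs_self _).trans h3)
  rw [Finset.sum_eq_zero_iff_of_nonneg fun i _ =>
    mul_nonneg (hc.1 _) (sub_nonneg.2 (h2 i))] at h1
  obtain ⟨v, hv'⟩ : ∃ v, v = ‖u‖⁻¹ • u := ⟨_, rfl⟩
  have hv : ‖v‖ = 1 := by simp [hv', norm_smul, hu']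
  -- An edge of length zero may point anywhere; its sign does not matter and is set to `1`.
  let ε : Fin n → ℝ := fun i => if c i.castSucc = 0 then 1 else inner ℝ (z i) v
  have h3 : ∀ i, c i.castSucc ≠ 0 → inner ℝ (z i) v ^ 2 = (1 : ℝ) := fun i hi => by
    have h4 := (mul_eq_zero.1 (h1 i (Finset.mem_univ i))).resolve_left hi
    rw [hv', inner_smul_right, mul_pow, ← sub_eq_zero.1 h4]
    field_simp
  have h4 : ∀ i, ε i = 1 ∨ ε i = -1 := fun i => by
    by_cases hi : c i.castSucc = 0
    · simp [ε, hi]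
    · simpa [ε, hi] using h3 i hi
  have h5 : ∀ i, c i.castSucc • z i = (c i.castSucc * ε i) • v := fun i => by
    by_cases hi : c i.castSucc = 0
    · simp [hi]
    · rw [mul_smul]
      simp only [ε, hi, if_false]
      rw [← eq_inner_smul_of_sq_eq_one (hz.1 i) hv (h3 i hi)]
  have h6 := hz.2
  simp only [h5, ← Finset.sum_smul] at h6
  have h7 := congrArg norm h6
  rw [norm_smul, norm_smul, hv, norm_e₁, mul_one, mul_one,
    Real.norm_eq_abs, Real.norm_eq_abs, abs_of_pos hc.2.1] at h7
  -- The signs refer to `v`, which is `e₁` up to sign; in the opposite case all signs are flipped.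
  rcases abs_eq (hc.2.1.le) |>.1 h7 with h8 | h8
  · exact hc.2.2 ε h4 (by rw [linedSum, h8, sub_self])
  · refine hc.2.2 (fun i => -ε i) (fun i => ?_) ?_
    · rcases h4 i with h | h <;> simp [h]
    · simp only [linedSum, mul_neg, Finset.sum_neg_distrib, h8]
      ring

/-- The derivative of the defect with respect to the translation. -/
theorem exists_hasFDerivAt_chainDefect {c : Fin (n + 1) → ℝ} (hc : c ∈ weaklyGeneric n)
    {z : Fin n → EuclideanSpace ℝ (Fin 3)} (hz : z ∈ chains 3 c) :
    ∃ M : EuclideanSpace ℝ (Fin 3) ≃L[ℝ] EuclideanSpace ℝ (Fin 3),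
      HasFDerivAt (fun w => chainDefect ((c, z), w))
        (M : EuclideanSpace ℝ (Fin 3) →L[ℝ] EuclideanSpace ℝ (Fin 3)) 0 := by
  let M : EuclideanSpace ℝ (Fin 3) →L[ℝ] EuclideanSpace ℝ (Fin 3) :=
    ∑ i, c i.castSucc • ((2 : ℝ) • (ContinuousLinearMap.id ℝ (EuclideanSpace ℝ (Fin 3)) -
      (innerSL ℝ (z i)).smulRight (z i)))
  have hM : HasFDerivAt (fun w => chainDefect ((c, z), w)) M 0 := by
    simp only [chainDefect]
    refine HasFDerivAt.sub_const _ (HasFDerivAt.fun_sum fun i _ => ?_)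
    exact (hasFDerivAt_boost (hz.1 i)).const_smul (c i.castSucc)
  have hinj : Function.Injective (M : EuclideanSpace ℝ (Fin 3) →ₗ[ℝ] EuclideanSpace ℝ (Fin 3)) := by
    refine (injective_iff_map_eq_zero _).2 fun u hu => eq_zero_of_sum_projection_eq_zero hc hz ?_
    have h1 : (2 : ℝ) • ∑ i, c i.castSucc • (u - (inner ℝ (z i) u : ℝ) • z i) = 0 := by
      rw [← hu, Finset.smul_sum]
      simp [M, smul_comm (2 : ℝ)]
    exact (smul_eq_zero.1 h1).resolve_left two_ne_zero
  exact ⟨(LinearEquiv.ofInjectiveEndo _ hinj).toContinuousLinearEquiv, hM⟩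

/-- The implicit function theorem at `w = 0`. Lengths and chain are parameters together, so that the
result is uniform in both near `(c, z)`. -/
theorem exists_smooth_solution {c : Fin (n + 1) → ℝ} (hc : c ∈ weaklyGeneric n)
    {z : Fin n → EuclideanSpace ℝ (Fin 3)} (hz : z ∈ chains 3 c) :
    ∃ (Q : Set ((Fin (n + 1) → ℝ) × (Fin n → EuclideanSpace ℝ (Fin 3))))
      (W : (Fin (n + 1) → ℝ) × (Fin n → EuclideanSpace ℝ (Fin 3)) → EuclideanSpace ℝ (Fin 3)),
      IsOpen Q ∧ (c, z) ∈ Q ∧ ContDiffOn ℝ ∞ W Q ∧ W (c, z) = 0 ∧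
      (∀ p ∈ Q, chainDefect (p, W p) = 0) ∧ ∃ O ∈ 𝓝 ((c, z), (0 : EuclideanSpace ℝ (Fin 3))),
        ∀ p w w', (p, w) ∈ O → (p, w') ∈ O →
        chainDefect (p, w) = 0 → chainDefect (p, w') = 0 → w = w' := by
  obtain ⟨M, hM⟩ := exists_hasFDerivAt_chainDefect hc hz
  refine exists_smooth_implicit isOpen_add_ne_zero contDiffOn_chainDefect (fun i => ?_)
    (mem_chains_iff.1 hz).2 hM
  have h1 : z i ≠ 0 := norm_ne_zero_iff.1 (by simp [hz.1 i])
  simpa using h1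

theorem isCompact_unitVectors :
    IsCompact {z : Fin n → EuclideanSpace ℝ (Fin 3) | ∀ i, ‖z i‖ = 1} := by
  have h1 := isCompact_univ_pi fun _ : Fin n => isCompact_sphere (0 : EuclideanSpace ℝ (Fin 3)) 1
  convert h1 using 1
  ext z
  simp

theorem continuousAt_chainDefect_zero (c : Fin (n + 1) → ℝ)
    {z : Fin n → EuclideanSpace ℝ (Fin 3)} (hz : ∀ i, ‖z i‖ = 1) :
    ContinuousAt (fun p : (Fin (n + 1) → ℝ) × (Fin n → EuclideanSpace ℝ (Fin 3)) =>
      chainDefect (p, 0)) (c, z) := by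
  have h1 : ((c, z), (0 : EuclideanSpace ℝ (Fin 3))) ∈ {q : ((Fin (n + 1) → ℝ) ×
    (Fin n → EuclideanSpace ℝ (Fin 3))) × EuclideanSpace ℝ (Fin 3) | ∀ i, q.1.2 i + q.2 ≠ 0} :=
    fun i => add_ne_zero_of_norm (hz i) (by simp)
  have h2 := contDiffOn_chainDefect.continuousOn.continuousAt (isOpen_add_ne_zero.mem_nhds h1)
  exact ContinuousAt.comp (f := fun p : (Fin (n + 1) → ℝ) × (Fin n → EuclideanSpace ℝ (Fin 3)) =>
    (p, (0 : EuclideanSpace ℝ (Fin 3)))) h2 (by fun_prop)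

/-- To check a property for all chains with lengths close to `c₀`, it suffices to check it close
to each chain with lengths `c₀`. -/
theorem eventually_forall_chains {Y : Type*} [TopologicalSpace Y] {y₀ : Y}
    {l : Y → Fin (n + 1) → ℝ} (hl : Continuous l)
    {P : Y → (Fin n → EuclideanSpace ℝ (Fin 3)) → Prop}
    (hP : ∀ z ∈ chains 3 (l y₀), ∀ᶠ q : Y × (Fin n → EuclideanSpace ℝ (Fin 3)) in 𝓝 (y₀, z),
      P q.1 q.2) :
    ∀ᶠ y in 𝓝 y₀, ∀ z ∈ chains 3 (l y), P y z := by
  have h1 := isCompact_unitVectors (n := n).eventually_forall_of_forall_eventually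
    (x₀ := y₀) (P := fun y z => chainDefect ((l y, z), 0) = 0 → P y z) fun z hz => by
      by_cases h2 : chainDefect ((l y₀, z), 0) = 0
      · filter_upwards [hP z (mem_chains_iff.2 ⟨hz, h2⟩)] with q hq _ using hq
      -- If `z` is not a chain for `l y₀`, its defect stays nonzero nearby and the implication is
      -- vacuous there.
      · have h3 : ContinuousAt (fun q : Y × (Fin n → EuclideanSpace ℝ (Fin 3)) =>
            chainDefect ((l q.1, q.2), 0)) (y₀, z) :=
          ContinuousAt.comp (x := (y₀, z)) (f := fun q : Y × (Fin n → EuclideanSpace ℝ (Fin 3)) =>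
            (l q.1, q.2)) (continuousAt_chainDefect_zero (l y₀) hz) (by fun_prop)
        filter_upwards [h3.eventually_ne h2] with q hq hq' using absurd hq' hq
  filter_upwards [h1] with y hy z hz using hy z hz.1 (mem_chains_iff.1 hz).2

/-- Small translations of the chains for the lengths `c` to chains for the lengths `c'` are
unique. -/
def UniqueSolutions (r : ℝ) (c c' : Fin (n + 1) → ℝ) : Prop :=
  ∀ z ∈ chains 3 c, ∀ w w' : EuclideanSpace ℝ (Fin 3), ‖w‖ < r → ‖w'‖ < r →
    chainDefect ((c', z), w) = 0 → chainDefect ((c', z), w') = 0 → w = w'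

/-- The chains for the lengths `c` can be translated to chains for the lengths `c'` by small
translations which are, locally, smooth functions of the chain. -/
def SmoothSolutions (r : ℝ) (c c' : Fin (n + 1) → ℝ) : Prop :=
  ∀ z ∈ chains 3 c, ∃ (Q : Set (Fin n → EuclideanSpace ℝ (Fin 3)))
    (W : (Fin n → EuclideanSpace ℝ (Fin 3)) → EuclideanSpace ℝ (Fin 3)),
    IsOpen Q ∧ z ∈ Q ∧ ContDiffOn ℝ ∞ W Q ∧
      ∀ z' ∈ Q, ‖W z'‖ < r ∧ chainDefect ((c', z'), W z') = 0

/-- The two translations are counted among the parameters, so compactness over the chains provides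
one neighbourhood for all of them; a product neighbourhood inside it contains the radius `r`. -/
theorem eventually_unique_solution {c₀ : Fin (n + 1) → ℝ} (hc₀ : c₀ ∈ weaklyGeneric n) :
    ∃ r > 0, ∀ᶠ p : (Fin (n + 1) → ℝ) × (Fin (n + 1) → ℝ) in 𝓝 (c₀, c₀),
      UniqueSolutions r p.1 p.2 := by
  have h1 := eventually_forall_chains (n := n)
    (Y := ((Fin (n + 1) → ℝ) × (Fin (n + 1) → ℝ)) ×
      (EuclideanSpace ℝ (Fin 3) × EuclideanSpace ℝ (Fin 3)))
    (y₀ := ((c₀, c₀), (0, 0))) (l := fun y => y.1.1) (by fun_prop)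
    (P := fun y z => chainDefect ((y.1.2, z), y.2.1) = 0 →
      chainDefect ((y.1.2, z), y.2.2) = 0 → y.2.1 = y.2.2) fun z hz => by
      obtain ⟨-, -, -, -, -, -, -, O, hO, h⟩ := exists_smooth_solution hc₀ hz
      let g (i : EuclideanSpace ℝ (Fin 3) × EuclideanSpace ℝ (Fin 3) → EuclideanSpace ℝ (Fin 3))
        (q : (((Fin (n + 1) → ℝ) × (Fin (n + 1) → ℝ)) ×
          (EuclideanSpace ℝ (Fin 3) × EuclideanSpace ℝ (Fin 3))) ×
          (Fin n → EuclideanSpace ℝ (Fin 3))) := ((q.1.1.2, q.2), i q.1.2)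
      have h2 : ContinuousAt (g Prod.fst) (((c₀, c₀), (0, 0)), z) := by
        unfold g
        fun_prop
      have h3 : ContinuousAt (g Prod.snd) (((c₀, c₀), (0, 0)), z) := by
        unfold g
        fun_prop
      filter_upwards [h2.preimage_mem_nhds hO, h3.preimage_mem_nhds hO] with q hq hq'
      exact h _ _ _ hq hq'
  rw [nhds_prod_eq] at h1
  obtain ⟨A, hA, B, hB, h2⟩ := Filter.eventually_prod_iff.1 h1
  obtain ⟨r, hr, h3⟩ := Metric.eventually_nhds_iff.1 hB
  refine ⟨r, hr, ?_⟩
  filter_upwards [hA] with p hp z hz w w' hw hw'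
  refine h2 hp (y := (w, w')) (h3 ?_) z hz
  rw [Prod.dist_eq]
  simpa using And.intro hw hw'

/-- The implicit solution vanishes at `(c₀, z)`, hence remains shorter than `r` nearby; freezing the
target lengths gives a smooth function of the chain alone. -/
theorem eventually_exists_solution {c₀ : Fin (n + 1) → ℝ} (hc₀ : c₀ ∈ weaklyGeneric n)
    {r : ℝ} (hr : 0 < r) :
    ∀ᶠ p : (Fin (n + 1) → ℝ) × (Fin (n + 1) → ℝ) in 𝓝 (c₀, c₀),
      SmoothSolutions r p.1 p.2 := by
  refine eventually_forall_chains (l := Prod.fst) (y₀ := (c₀, c₀)) continuous_fst fun z hz => ?_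
  obtain ⟨Q, W, hQ, hzQ, hW, hW0, h, -⟩ := exists_smooth_solution hc₀ hz
  have hQ' : IsOpen (Q ∩ W ⁻¹' Metric.ball 0 r) :=
    hW.continuousOn.isOpen_inter_preimage hQ Metric.isOpen_ball
  have h1 : (c₀, z) ∈ Q ∩ W ⁻¹' Metric.ball 0 r := ⟨hzQ, by simpa [hW0] using hr⟩
  have h2 : ContinuousAt (fun q : ((Fin (n + 1) → ℝ) × (Fin (n + 1) → ℝ)) ×
      (Fin n → EuclideanSpace ℝ (Fin 3)) => (q.1.2, q.2)) ((c₀, c₀), z) := by fun_prop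
  filter_upwards [h2.preimage_mem_nhds (hQ'.mem_nhds h1)] with q hq
  have h3 : ContDiff ℝ ∞ fun z' : Fin n → EuclideanSpace ℝ (Fin 3) => (q.1.2, z') := by fun_prop
  refine ⟨(fun z' => (q.1.2, z')) ⁻¹' (Q ∩ W ⁻¹' Metric.ball 0 r), fun z' => W (q.1.2, z'),
    hQ'.preimage h3.continuous, hq, (hW.mono Set.inter_subset_left).comp h3.contDiffOn
      fun _ h => h, fun z' hz' => ⟨by simpa using hz'.2, h _ hz'.1⟩⟩

theorem UniqueSolutions.mono {r r' : ℝ} {c c' : Fin (n + 1) → ℝ} (h : UniqueSolutions r c c')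
    (hr : r' ≤ r) : UniqueSolutions r' c c' :=
  fun z hz w w' hw hw' => h z hz w w' (hw.trans_le hr) (hw'.trans_le hr)

section Solution

variable {c c' : Fin (n + 1) → ℝ} {r : ℝ} {w : chains 3 c → EuclideanSpace ℝ (Fin 3)}

theorem SmoothSolutions.exists_solution (he : SmoothSolutions r c c') :
    ∀ z : chains 3 c, ∃ w, ‖w‖ < r ∧ chainDefect ((c', z), w) = 0 := by
  intro z
  obtain ⟨Q, W, -, hz, -, h⟩ := he z z.2
  exact ⟨W z, h z hz⟩

/-- The solutions `w` are chosen point by point; uniqueness forces them to coincide with the smooth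
local ones. -/
theorem SmoothSolutions.smoothAt (he : SmoothSolutions r c c') (hr : r ≤ 1)
    (hu : UniqueSolutions r c c') (hw : ∀ z, ‖w z‖ < r)
    (hw0 : ∀ z : chains 3 c, chainDefect ((c', z), w z) = 0) (z : chains 3 c) :
    SmoothAt (fun z : chains 3 c => (fun i => boost (w z) (z.1 i) :
      Fin n → EuclideanSpace ℝ (Fin 3))) z := by
  obtain ⟨Q, W, hQ, hz, hW, h⟩ := he z z.2
  have h1 : IsOpen {y : Fin n → EuclideanSpace ℝ (Fin 3) | ∀ i, 0 < ‖y i‖} := by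
    simp only [Set.ofPred_forall]
    exact isOpen_iInter_of_finite fun i => isOpen_lt continuous_const (by fun_prop)
  have hWc : ContinuousOn (fun y => fun i => y i + W y) Q :=
    continuousOn_id.fun_add (continuousOn_pi.2 fun _ => hW.continuousOn)
  refine ⟨Q ∩ (fun y => fun i => y i + W y) ⁻¹' {y | ∀ i, 0 < ‖y i‖},
    fun y i => boost (W y) (y i), hWc.isOpen_inter_preimage hQ h1, ⟨hz, fun i => ?_⟩, ?_,
    fun y hy => ?_⟩
  · exact norm_pos_iff.2 (add_ne_zero_of_norm (z.2.1 i) ((h z hz).1.trans_le hr))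
  · refine contDiffOn_pi.2 fun i => ?_
    have h2 : ContDiffOn ℝ ∞ (fun y : Fin n → EuclideanSpace ℝ (Fin 3) => (W y, y i))
        (Q ∩ (fun y => fun i => y i + W y) ⁻¹' {y | ∀ i, 0 < ‖y i‖}) :=
      (hW.mono Set.inter_subset_left).prodMk (ContDiff.contDiffOn (by fun_prop))
    exact contDiffOn_boost.comp h2 fun y hy => norm_pos_iff.1 (hy.2 i)
  · have h2 : w y = W y := hu y y.2 _ _ (hw y) (h y hy.1).1 (hw0 y) (h y hy.1).2
    simp only [h2]

/-- The vector `R • w x` closes up `R • x` and is as short as `w x`, so by uniqueness it is the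
solution at `R • x`. -/
theorem UniqueSolutions.boost_smul (hu : UniqueSolutions r c c') (hw : ∀ z, ‖w z‖ < r)
    (hw0 : ∀ z : chains 3 c, chainDefect ((c', z), w z) = 0) (R : axisRotations 3)
    (x y : chains 3 c) (hxy : y.1 = R • x.1) :
    (fun i => boost (w y) (y.1 i)) = R • fun i => boost (w x) (x.1 i) := by
  have h1 : w y = R • w x := by
    refine hu y y.2 _ _ (hw y) ((norm_smul_rotation R _).trans_lt (hw x)) (hw0 y) ?_
    rw [hxy, chainDefect_smul, hw0]
    exact map_zero (R : EuclideanSpace ℝ (Fin 3) ≃ₗ[ℝ] EuclideanSpace ℝ (Fin 3))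
  rw [h1, hxy]
  funext i
  exact boost_map (R := (R : EuclideanSpace ℝ (Fin 3) ≃ₗ[ℝ] EuclideanSpace ℝ (Fin 3)).toLinearMap)
    R.2.1 (w x) (x.1 i)

/-- Translating `y` by `-v` gives back `x`, which is a chain for `c'`; uniqueness then yields `w y =
-v`. -/
theorem UniqueSolutions.boost_boost (hu : UniqueSolutions r c c') (hr : r ≤ 1)
    (hw : ∀ z, ‖w z‖ < r) (hw0 : ∀ z : chains 3 c, chainDefect ((c', z), w z) = 0)
    {v : EuclideanSpace ℝ (Fin 3)} (hv : ‖v‖ < r) (x : chains 3 c') (y : chains 3 c)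
    (hxy : y.1 = fun i => boost v (x.1 i)) : (fun i => boost (w y) (y.1 i)) = x.1 := by
  have h1 : ∀ i, boost (-v) (y.1 i) = x.1 i := fun i => by
    rw [hxy]
    exact boost_neg_boost (x.2.1 i) (hv.trans_le hr)
  have h2 : w y = -v := by
    refine hu y y.2 _ _ (hw y) (by rwa [norm_neg]) (hw0 y) ?_
    simp only [chainDefect, h1]
    exact sub_eq_zero.2 x.2.2
  rw [h2]
  exact funext h1

end Solution

theorem equivariantDiffeo_of_solutions {c c' : Fin (n + 1) → ℝ} {r : ℝ} (hr : r ≤ 1)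
    (hu : UniqueSolutions r c c') (hu' : UniqueSolutions r c' c)
    (he : SmoothSolutions r c c') (he' : SmoothSolutions r c' c) :
    EquivariantDiffeo (d := 3) (chains 3 c) (chains 3 c') := by
  choose w hw hw0 using he.exists_solution
  choose w' hw' hw0' using he'.exists_solution
  let f : chains 3 c → chains 3 c' := fun z =>
    ⟨fun i => boost (w z) (z.1 i), boost_mem_chains z.2.1 ((hw z).trans_le hr) (hw0 z)⟩
  let g : chains 3 c' → chains 3 c := fun z =>
    ⟨fun i => boost (w' z) (z.1 i), boost_mem_chains z.2.1 ((hw' z).trans_le hr) (hw0' z)⟩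
  exact ⟨f, g, he.smoothAt hr hu hw hw0, he'.smoothAt hr hu' hw' hw0',
    fun x => Subtype.ext (hu'.boost_boost hr hw' hw0' (hw x) x (f x) rfl),
    fun x => Subtype.ext (hu.boost_boost hr hw hw0 (hw' x) x (g x) rfl),
    hu.boost_smul hw hw0, hu'.boost_smul hw' hw0'⟩

theorem eventually_equivariantDiffeo {c₀ : Fin (n + 1) → ℝ} (hc₀ : c₀ ∈ weaklyGeneric n) :
    ∀ᶠ c in 𝓝 c₀, EquivariantDiffeo (d := 3) (chains 3 c₀) (chains 3 c) := by
  obtain ⟨r, hr, hu⟩ := eventually_unique_solution hc₀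
  -- The bound `r` is needed for uniqueness, the bound `1` for the boosts to preserve the sphere and
  -- be invertible.
  have he := eventually_exists_solution hc₀ (lt_min hr one_pos)
  have h1 : Filter.Tendsto (fun c : Fin (n + 1) → ℝ => (c₀, c)) (𝓝 c₀) (𝓝 (c₀, c₀)) :=
    (Continuous.prodMk_right c₀).tendsto c₀
  have h2 : Filter.Tendsto (fun c : Fin (n + 1) → ℝ => (c, c₀)) (𝓝 c₀) (𝓝 (c₀, c₀)) :=
    (Continuous.prodMk_left c₀).tendsto c₀
  filter_upwards [h1.eventually hu, h2.eventually hu, h1.eventually he, h2.eventually he]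
    with c hu1 hu2 he1 he2
  exact equivariantDiffeo_of_solutions (min_le_right r 1) (hu1.mono (min_le_left _ _))
    (hu2.mono (min_le_left _ _)) he1 he2

/-- The chain spaces of the length vectors of a connected family are diffeomorphic. -/
theorem equivariantDiffeo_of_isPreconnected {K : Set (Fin (n + 1) → ℝ)}
    (hK : IsPreconnected K) (hK' : K ⊆ weaklyGeneric n) {c c' : Fin (n + 1) → ℝ}
    (hc : c ∈ K) (hc' : c' ∈ K) : EquivariantDiffeo (d := 3) (chains 3 c) (chains 3 c') :=
  -- An equivalence relation that relates each point to all nearby points relates any two points of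
  -- a preconnected set.
  hK.induction₂ (fun c c' => EquivariantDiffeo (d := 3) (chains 3 c) (chains 3 c'))
    (fun _ hx => nhdsWithin_le_nhds (eventually_equivariantDiffeo (hK' hx)))
    (fun _ _ _ _ _ _ h h' => h.trans h') (fun _ _ _ _ h => h.symm) hc hc'

/-- A chain with a first edge of length zero is a point of the sphere and a chain. -/
theorem equivariantDiffeo_cons_zero (b : Fin (n + 1) → ℝ) :
    EquivariantDiffeo (d := 3) (chains 3 (Fin.cons 0 b : Fin (n + 2) → ℝ))
      (sphereTimesChains b) := by
  have h1 : ∀ z : Fin (n + 1) → EuclideanSpace ℝ (Fin 3),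
      z ∈ chains 3 (Fin.cons 0 b : Fin (n + 2) → ℝ) ↔
        (z 0, fun i : Fin n => z i.succ) ∈ sphereTimesChains b := by
    intro z
    simp only [chains, sphereTimesChains, Set.mem_ofPred_eq, Fin.forall_fin_succ,
      Fin.sum_univ_succ, ← Fin.succ_last, Fin.castSucc_zero, Fin.cons_zero, ← Fin.succ_castSucc,
      Fin.cons_succ, zero_smul, zero_add, and_assoc]
  have h2 : ∀ p : EuclideanSpace ℝ (Fin 3) × (Fin n → EuclideanSpace ℝ (Fin 3)),
      p ∈ sphereTimesChains b → (Fin.cons p.1 p.2 : Fin (n + 1) → EuclideanSpace ℝ (Fin 3)) ∈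
        chains 3 (Fin.cons 0 b : Fin (n + 2) → ℝ) := by
    intro p hp
    rw [h1]
    simpa using hp
  refine ⟨fun z => ⟨(z.1 0, fun i => z.1 i.succ), (h1 _).1 z.2⟩,
    fun p => ⟨Fin.cons p.1.1 p.1.2, h2 _ p.2⟩, fun z => ?_, fun p => ?_, fun z => ?_,
    fun p => ?_, fun R x y hxy => ?_, fun R x y hxy => ?_⟩
  · exact SmoothAt.of_contDiff (F := fun z : Fin (n + 1) → EuclideanSpace ℝ (Fin 3) =>
      (z 0, fun i : Fin n => z i.succ)) (by fun_prop) z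
  · refine SmoothAt.of_contDiff (F := fun p : EuclideanSpace ℝ (Fin 3) ×
      (Fin n → EuclideanSpace ℝ (Fin 3)) => (Fin.cons p.1 p.2 : Fin (n + 1) →
        EuclideanSpace ℝ (Fin 3))) (contDiff_pi.2 fun i => ?_) p
    refine Fin.cases ?_ (fun j => ?_) i
    · simpa using contDiff_fst
    · simp only [Fin.cons_succ]
      fun_prop
  · exact Subtype.ext (Fin.cons_self_tail z.1)
  · simp
  · simp only [hxy]
    rfl
  · simp only [hxy]
    funext i
    refine Fin.cases ?_ (fun j => ?_) i <;> simp

/-- Adding a tiny edge to the chains amounts to taking the product with a sphere. -/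
theorem equivariantDiffeo_plusChamber {α : Set (Fin (n + 1) → ℝ)} (hα : IsChamber α)
    {b : Fin (n + 1) → ℝ} (hb : b ∈ α) {a : Fin (n + 2) → ℝ} (ha : a ∈ plusChamber α) :
    EquivariantDiffeo (d := 3) (chains 3 a) (sphereTimesChains b) := by
  have h1 := cons_zero_mem_weaklyGeneric
    (genericOrdered_subset n (mem_genericOrdered_of_isChamber hα hb))
  have h2 := genericOrdered_subset (n + 1) (mem_genericOrdered_of_mem_plusChamber ha)
  have h3 := segment_subset_weaklyGeneric h1 h2 fun ε hε =>
    linedSum_pos_iff_of_mem_plusChamber hα hb ha hε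
  exact (equivariantDiffeo_of_isPreconnected (convex_segment _ _).isPreconnected h3
    (right_mem_segment ℝ _ _) (left_mem_segment ℝ _ _)).trans (equivariantDiffeo_cons_zero b)

end Perturbation

/-! ### Rotations about the first axis of `ℝ³` -/

/-- The linear map of `ℝ³` which fixes the first axis and multiplies the plane orthogonal to it,
identified with `ℂ`, by `c + is`. -/
def turn (c s : ℝ) (x : EuclideanSpace ℝ (Fin 3)) : EuclideanSpace ℝ (Fin 3) :=
  !₂[x 0, c * x 1 - s * x 2, s * x 1 + c * x 2]

@[simp] theorem turn_zero (c s : ℝ) (x : EuclideanSpace ℝ (Fin 3)) : turn c s x 0 = x 0 := rfl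

@[simp] theorem turn_one (c s : ℝ) (x : EuclideanSpace ℝ (Fin 3)) :
    turn c s x 1 = c * x 1 - s * x 2 := rfl

@[simp] theorem turn_two (c s : ℝ) (x : EuclideanSpace ℝ (Fin 3)) :
    turn c s x 2 = s * x 1 + c * x 2 := rfl

theorem ext_three {x y : EuclideanSpace ℝ (Fin 3)} (h0 : x 0 = y 0) (h1 : x 1 = y 1)
    (h2 : x 2 = y 2) : x = y := by
  ext i
  fin_cases i <;> assumption

theorem norm_sq_three (x : EuclideanSpace ℝ (Fin 3)) :
    ‖x‖ ^ 2 = x 0 ^ 2 + x 1 ^ 2 + x 2 ^ 2 := by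
  simp [EuclideanSpace.norm_sq_eq, Fin.sum_univ_three]

theorem inner_three (x y : EuclideanSpace ℝ (Fin 3)) :
    inner ℝ x y = x 0 * y 0 + x 1 * y 1 + x 2 * y 2 := by
  simp [PiLp.inner_apply, Fin.sum_univ_three, mul_comm]

@[simp] theorem e₁_zero : e₁ 3 0 = 1 := by simp [e₁]

@[simp] theorem e₁_one : e₁ 3 1 = 0 := by simp [e₁]

@[simp] theorem e₁_two : e₁ 3 2 = 0 := by simp [e₁]

/-- The map `turn c s` as a linear equivalence. -/
def turnEquiv (c s : ℝ) (h : c ^ 2 + s ^ 2 = 1) :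
    EuclideanSpace ℝ (Fin 3) ≃ₗ[ℝ] EuclideanSpace ℝ (Fin 3) where
  toFun := turn c s
  invFun := turn c (-s)
  map_add' x y := by apply ext_three <;> simp <;> ring
  map_smul' r x := by apply ext_three <;> simp <;> ring
  left_inv x := by
    apply ext_three
    · simp
    · simp only [turn_one, turn_two]
      linear_combination x 1 * h
    · simp only [turn_one, turn_two]
      linear_combination x 2 * h
  right_inv x := by
    apply ext_three
    · simp
    · simp only [turn_one, turn_two]
      linear_combination x 1 * h
    · simp only [turn_one, turn_two]
      linear_combination x 2 * h

theorem det_three (f : EuclideanSpace ℝ (Fin 3) →ₗ[ℝ] EuclideanSpace ℝ (Fin 3)) :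
    LinearMap.det f = (Matrix.of fun i j : Fin 3 => f (EuclideanSpace.single j 1) i).det := by
  rw [← LinearMap.det_toMatrix (EuclideanSpace.basisFun (Fin 3) ℝ).toBasis]
  congr 1

/-- The rotation about the first axis given by a point `(c, s)` of the unit circle. -/
def rotation (c s : ℝ) (h : c ^ 2 + s ^ 2 = 1) : axisRotations 3 :=
  ⟨turnEquiv c s h, by
    refine ⟨fun x => ?_, ?_, ?_⟩
    · rw [← sq_eq_sq₀ (norm_nonneg _) (norm_nonneg _), norm_sq_three, norm_sq_three]
      change x 0 ^ 2 + (c * x 1 - s * x 2) ^ 2 + (s * x 1 + c * x 2) ^ 2 = _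
      linear_combination (x 1 ^ 2 + x 2 ^ 2) * h
    · rw [← Units.val_inj, LinearEquiv.coe_det, det_three, Matrix.det_fin_three]
      simp [turnEquiv]
      linear_combination h
    · change turn c s (e₁ 3) = e₁ 3
      apply ext_three <;> simp⟩

theorem exists_eq_turn (R : axisRotations 3) :
    ∃ c s : ℝ, c ^ 2 + s ^ 2 = 1 ∧ ∀ x : EuclideanSpace ℝ (Fin 3), R • x = turn c s x := by
  obtain ⟨A, hA, hd, h1⟩ := R
  change ∃ c s : ℝ, c ^ 2 + s ^ 2 = 1 ∧ ∀ x : EuclideanSpace ℝ (Fin 3), A x = turn c s x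
  have hi : ∀ x y, inner ℝ (A x) (A y) = (inner ℝ x y : ℝ) := fun x y =>
    LinearIsometry.inner_map_map (⟨A.toLinearMap, hA⟩ :
      EuclideanSpace ℝ (Fin 3) →ₗᵢ[ℝ] EuclideanSpace ℝ (Fin 3)) x y
  set p := A (EuclideanSpace.single 1 1) with hp
  set q := A (EuclideanSpace.single 2 1) with hq
  have h1' : A (EuclideanSpace.single 0 1) = e₁ 3 := h1
  have hp0 : p 0 = 0 := by
    have := hi (EuclideanSpace.single 1 1) (e₁ 3)
    rw [h1, inner_three, inner_three] at this
    simpa using this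
  have hq0 : q 0 = 0 := by
    have := hi (EuclideanSpace.single 2 1) (e₁ 3)
    rw [h1, inner_three, inner_three] at this
    simpa using this
  have hpp : p 1 ^ 2 + p 2 ^ 2 = 1 := by
    have := hi (EuclideanSpace.single 1 1) (EuclideanSpace.single 1 1)
    rw [inner_three, inner_three, ← hp, hp0] at this
    simp at this
    linarith
  have hpq : p 1 * q 1 + p 2 * q 2 = 0 := by
    have := hi (EuclideanSpace.single 1 1) (EuclideanSpace.single 2 1)
    rw [inner_three, inner_three, ← hp, ← hq, hp0] at this
    simpa using this
  have hdet : p 1 * q 2 - p 2 * q 1 = 1 := by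
    have h2 := congrArg Units.val hd
    rw [LinearEquiv.coe_det, det_three, Matrix.det_fin_three] at h2
    simp only [Matrix.of_apply, LinearEquiv.coe_coe, h1', ← hp, ← hq, e₁_zero, e₁_one, e₁_two,
      hp0, hq0, Units.val_one] at h2
    linarith
  -- In the plane, `‖p‖ = 1`, `p ⊥ q` and `det (p, q) = 1` force `q` to be the quarter turn of `p`.
  have hq2 : q 2 = p 1 := by linear_combination p 1 * hdet + p 2 * hpq - q 2 * hpp
  have hq1 : q 1 = -p 2 := by linear_combination p 1 * hpq - p 2 * hdet - q 1 * hpp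
  refine ⟨p 1, p 2, hpp, fun x => ?_⟩
  have hx : x = x 0 • EuclideanSpace.single 0 1 + x 1 • EuclideanSpace.single 1 1 +
      x 2 • EuclideanSpace.single 2 1 := by
    apply ext_three <;> simp
  have hAx : A x = x 0 • e₁ 3 + x 1 • p + x 2 • q := by
    conv_lhs => rw [hx]
    simp only [map_add, map_smul, h1', ← hp, ← hq]
  rw [hAx]
  apply ext_three
  · simp [hp0, hq0]
  · simp [hq1]; ring
  · simp [hq2]; ring

theorem contDiff_turn : ContDiff ℝ ∞ fun q : (ℝ × ℝ) × EuclideanSpace ℝ (Fin 3) =>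
    turn q.1.1 q.1.2 q.2 := by
  rw [contDiff_euclidean]
  intro i
  fin_cases i
  · change ContDiff ℝ ∞ fun q : (ℝ × ℝ) × EuclideanSpace ℝ (Fin 3) => q.2 0
    fun_prop
  · change ContDiff ℝ ∞ fun q : (ℝ × ℝ) × EuclideanSpace ℝ (Fin 3) =>
      q.1.1 * q.2 1 - q.1.2 * q.2 2
    fun_prop
  · change ContDiff ℝ ∞ fun q : (ℝ × ℝ) × EuclideanSpace ℝ (Fin 3) =>
      q.1.2 * q.2 1 + q.1.1 * q.2 2
    fun_prop

theorem continuous_rotation_smul (R : axisRotations 3) :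
    Continuous fun x : EuclideanSpace ℝ (Fin 3) => R • x := by
  obtain ⟨c, s, -, h⟩ := exists_eq_turn R
  simp only [h]
  exact contDiff_turn.continuous.comp (by fun_prop : Continuous fun x => ((c, s), x))

/-! ### The aligned representatives of the orbits -/

section Align

variable {n : ℕ}

/-- The square of the distance of the `i`-th vector from the first axis. -/
def axisDistSq (i : Fin n) (z : Fin n → EuclideanSpace ℝ (Fin 3)) : ℝ := z i 1 ^ 2 + z i 2 ^ 2

/-- The configuration obtained by rotating `z` such that the `i`-th vector comes to lie in the
half plane spanned by the first axis and the second vector of the standard basis. -/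
def align (i : Fin n) (z : Fin n → EuclideanSpace ℝ (Fin 3)) :
    Fin n → EuclideanSpace ℝ (Fin 3) :=
  fun j => turn (z i 1 / √(axisDistSq i z)) (-(z i 2) / √(axisDistSq i z)) (z j)

theorem exists_smul_eq_align {i : Fin n} {z : Fin n → EuclideanSpace ℝ (Fin 3)}
    (h : 0 < axisDistSq i z) : ∃ R : axisRotations 3, R • z = align i z := by
  have h1 : (z i 1 / √(axisDistSq i z)) ^ 2 + (-(z i 2) / √(axisDistSq i z)) ^ 2 = 1 := by
    rw [div_pow, div_pow, neg_sq, Real.sq_sqrt h.le, ← add_div]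
    exact div_self h.ne'
  exact ⟨rotation _ _ h1, rfl⟩

theorem axisDistSq_smul (i : Fin n) (R : axisRotations 3)
    (z : Fin n → EuclideanSpace ℝ (Fin 3)) : axisDistSq i (R • z) = axisDistSq i z := by
  obtain ⟨c, s, h, hR⟩ := exists_eq_turn R
  simp only [axisDistSq, Pi.smul_apply, hR, turn_one, turn_two]
  linear_combination (z i 1 ^ 2 + z i 2 ^ 2) * h

/-- The aligned configuration in terms of the invariants of the rotations. -/
theorem align_apply (i j : Fin n) (z : Fin n → EuclideanSpace ℝ (Fin 3)) :
    align i z j = !₂[z j 0, (z i 1 * z j 1 + z i 2 * z j 2) / √(axisDistSq i z),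
      (z i 1 * z j 2 - z i 2 * z j 1) / √(axisDistSq i z)] := by
  apply ext_three
  · rfl
  · simp [align]; ring
  · simp [align]; ring

/-- The entries of the aligned configuration are first coordinates and planar dot and cross
products, all invariant under rotation about the axis. -/
theorem align_smul (i : Fin n) (R : axisRotations 3) (z : Fin n → EuclideanSpace ℝ (Fin 3)) :
    align i (R • z) = align i z := by
  funext j
  rw [align_apply, align_apply, axisDistSq_smul]
  obtain ⟨c, s, h, hR⟩ := exists_eq_turn R
  apply ext_three
  · simp [hR]
  · simp only [Pi.smul_apply, hR, turn_one, turn_two, Matrix.cons_val]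
    congr 1
    linear_combination (z i 1 * z j 1 + z i 2 * z j 2) * h
  · simp only [Pi.smul_apply, hR, turn_one, turn_two, Matrix.cons_val]
    congr 1
    linear_combination (z i 1 * z j 2 - z i 2 * z j 1) * h

theorem align_apply_self_two (i : Fin n) (z : Fin n → EuclideanSpace ℝ (Fin 3)) :
    align i z i 2 = 0 := by
  rw [align_apply]
  simp [mul_comm]

theorem align_apply_self_one {i : Fin n} {z : Fin n → EuclideanSpace ℝ (Fin 3)}
    (h : 0 < axisDistSq i z) : 0 < align i z i 1 := by
  rw [align_apply]
  have : 0 < z i 1 * z i 1 + z i 2 * z i 2 := by simpa [axisDistSq, sq] using h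
  simp only [Matrix.cons_val]
  positivity

theorem align_eq_self {i : Fin n} {z : Fin n → EuclideanSpace ℝ (Fin 3)}
    (h1 : 0 < z i 1) (h2 : z i 2 = 0) : align i z = z := by
  have h3 : √(axisDistSq i z) = z i 1 := by simp [axisDistSq, h2, Real.sqrt_sq h1.le]
  funext j
  rw [align, h3, h2, div_self h1.ne']
  apply ext_three <;> simp

theorem continuous_axisDistSq (i : Fin n) : Continuous (axisDistSq i) := by
  unfold axisDistSq
  fun_prop

theorem isOpen_axisDistSq_pos (i : Fin n) : IsOpen {z | 0 < axisDistSq i z} :=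
  isOpen_lt continuous_const (continuous_axisDistSq i)

theorem contDiffOn_align (i : Fin n) : ContDiffOn ℝ ∞ (align i) {z | 0 < axisDistSq i z} := by
  refine contDiffOn_pi.2 fun j => ?_
  have h1 : ContDiff ℝ ∞ (axisDistSq i) := by
    unfold axisDistSq
    fun_prop
  have h2 : ContDiffOn ℝ ∞ (fun z => √(axisDistSq i z)) {z | 0 < axisDistSq i z} :=
    h1.contDiffOn.sqrt fun z hz => hz.ne'
  have h3 : ∀ z ∈ {z | 0 < axisDistSq i z}, √(axisDistSq i z) ≠ 0 :=
    fun z hz => (Real.sqrt_pos.2 hz).ne'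
  have h4 : ContDiffOn ℝ ∞ (fun z : Fin n → EuclideanSpace ℝ (Fin 3) => z i 1)
      {z | 0 < axisDistSq i z} := ContDiff.contDiffOn (by fun_prop)
  have h5 : ContDiffOn ℝ ∞ (fun z : Fin n → EuclideanSpace ℝ (Fin 3) => -(z i 2))
      {z | 0 < axisDistSq i z} := ContDiff.contDiffOn (by fun_prop)
  have h6 : ContDiffOn ℝ ∞ (fun z : Fin n → EuclideanSpace ℝ (Fin 3) => z j)
      {z | 0 < axisDistSq i z} := ContDiff.contDiffOn (by fun_prop)
  exact contDiff_turn.comp_contDiffOn (((h4.div h2 h3).prodMk (h5.div h2 h3)).prodMk h6)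

end Align

/-! ### The topology of the quotients -/

section Quotients

variable {n : ℕ}

theorem smul_mem_chains {a : Fin (n + 1) → ℝ} {z : Fin n → EuclideanSpace ℝ (Fin 3)}
    (R : axisRotations 3) (hz : z ∈ chains 3 a) : R • z ∈ chains 3 a := by
  refine mem_chains_iff.2 ⟨fun i => (norm_smul_rotation R _).trans (hz.1 i), ?_⟩
  have h1 := chainDefect_smul R a z 0
  rw [(mem_chains_iff.1 hz).2] at h1
  have h2 : R • (0 : EuclideanSpace ℝ (Fin 3)) = 0 :=
    map_zero (R : EuclideanSpace ℝ (Fin 3) ≃ₗ[ℝ] EuclideanSpace ℝ (Fin 3))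
  rwa [h2] at h1

/-- The saturation of an open set is the union of its rotated copies, each of which is open. -/
theorem isOpenQuotientMap_polygonSpace (a : Fin (n + 1) → ℝ) :
    IsOpenQuotientMap (Quotient.mk (orbitSetoid 3 (chains 3 a))) := by
  refine ⟨Quotient.mk_surjective, continuous_quotient_mk', fun U hU => ?_⟩
  obtain ⟨U', hU', rfl⟩ := isOpen_induced_iff.1 hU
  have h1 : Quotient.mk (orbitSetoid 3 (chains 3 a)) ⁻¹'
      (Quotient.mk (orbitSetoid 3 (chains 3 a)) '' (Subtype.val ⁻¹' U')) =
      ⋃ R : axisRotations 3, {z : chains 3 a | R • z.1 ∈ U'} := by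
    ext z
    simp only [Set.mem_preimage, Set.mem_image, Set.mem_iUnion, Set.mem_ofPred_eq]
    constructor
    · rintro ⟨y, hy, h⟩
      obtain ⟨R, hR⟩ := orbitSetoid_iff.1 (Quotient.exact h)
      exact ⟨R, hR ▸ hy⟩
    · rintro ⟨R, hR⟩
      exact ⟨⟨_, smul_mem_chains R z.2⟩, hR, Quotient.sound ⟨R, rfl⟩⟩
  refine isQuotientMap_quotient_mk'.isOpen_preimage.1 ?_
  change IsOpen (Quotient.mk (orbitSetoid 3 (chains 3 a)) ⁻¹' _)
  rw [h1]
  refine isOpen_iUnion fun R => hU'.preimage ?_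
  exact continuous_pi fun i => (continuous_rotation_smul R).comp
    ((continuous_apply i).comp continuous_subtype_val)

/-- Functions on configurations which are invariant under rotations about the first axis. -/
def rotationInvariants (z : Fin n → EuclideanSpace ℝ (Fin 3)) (i j : Fin n) : ℝ × ℝ × ℝ :=
  (z j 0, z i 1 * z j 1 + z i 2 * z j 2, z i 1 * z j 2 - z i 2 * z j 1)

theorem continuous_rotationInvariants : Continuous (rotationInvariants (n := n)) := by
  unfold rotationInvariants
  fun_prop

/-- The rotation invariants separate orbits, so they embed the quotient continuously and injectively
in a Hausdorff space. -/
theorem t2Space_polygonSpace (a : Fin (n + 1) → ℝ) : T2Space (PolygonSpace 3 a) := by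
  let g : chains 3 a → Fin n → Fin n → ℝ × ℝ × ℝ := fun z => rotationInvariants z.1
  have hg : ∀ x y, (orbitSetoid 3 (chains 3 a)) x y → g x = g y := by
    rintro x y ⟨R, hR : R • y.1 = x.1⟩
    obtain ⟨c, s, h, hR'⟩ := exists_eq_turn R
    funext i j
    simp only [g, rotationInvariants, ← hR, Pi.smul_apply, hR', turn_zero, turn_one, turn_two, Prod.mk.injEq, true_and]
    constructor
    · linear_combination (y.1 i 1 * y.1 j 1 + y.1 i 2 * y.1 j 2) * h
    · linear_combination (y.1 i 1 * y.1 j 2 - y.1 i 2 * y.1 j 1) * h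
  have hgc : Continuous g := continuous_rotationInvariants.comp continuous_subtype_val
  refine T2Space.of_injective_continuous (f := Quotient.lift g hg) ?_ (hgc.quotient_lift hg)
  intro x y
  induction x using Quotient.inductionOn with | h x => ?_
  induction y using Quotient.inductionOn with | h y => ?_
  intro hxy
  have h1 : ∀ i j, x.1 j 0 = y.1 j 0 ∧
      x.1 i 1 * x.1 j 1 + x.1 i 2 * x.1 j 2 = y.1 i 1 * y.1 j 1 + y.1 i 2 * y.1 j 2 ∧
      x.1 i 1 * x.1 j 2 - x.1 i 2 * x.1 j 1 = y.1 i 1 * y.1 j 2 - y.1 i 2 * y.1 j 1 := fun i j => by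
    simpa [g, rotationInvariants] using congrFun (congrFun hxy i) j
  have h2 : ∀ i, axisDistSq i x.1 = axisDistSq i y.1 := fun i => by
    have := (h1 i i).2.1
    simp only [axisDistSq]
    linarith
  apply Quotient.sound
  -- If a vector is off the axis, both points have the same aligned representative. Otherwise all
  -- vectors lie on the axis and the first coordinates determine them.
  by_cases h : ∃ i, 0 < axisDistSq i x.1
  · obtain ⟨i, hi⟩ := h
    obtain ⟨R, hR⟩ := exists_smul_eq_align hi
    obtain ⟨R', hR'⟩ := exists_smul_eq_align (h2 i ▸ hi)
    have h3 : align i x.1 = align i y.1 := by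
      funext j
      rw [align_apply, align_apply, h2, (h1 i j).1, (h1 i j).2.1, (h1 i j).2.2]
    refine ⟨R⁻¹ * R', ?_⟩
    change (R⁻¹ * R') • y.1 = x.1
    rw [mul_smul, hR', ← h3, ← hR, inv_smul_smul]
  · have h3 : ∀ z : chains 3 a, ∀ i, axisDistSq i z.1 ≤ 0 → z.1 i 1 = 0 ∧ z.1 i 2 = 0 := by
      intro z i hz
      simp only [axisDistSq] at hz
      constructor <;> nlinarith [sq_nonneg (z.1 i 1), sq_nonneg (z.1 i 2)]
    have h4 : x = y := by
      refine Subtype.ext (funext fun i => ?_)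
      have h5 : axisDistSq i x.1 ≤ 0 := not_lt.1 fun h6 => h ⟨i, h6⟩
      have h6 := h3 x i h5
      have h7 := h3 y i (h2 i ▸ h5)
      exact ext_three (h1 i i).1 (h6.1.trans h7.1.symm) (h6.2.trans h7.2.symm)
    rw [h4]

theorem secondCountableTopology_polygonSpace (a : Fin (n + 1) → ℝ) :
    SecondCountableTopology (PolygonSpace 3 a) :=
  TopologicalSpace.Quotient.secondCountableTopology (isOpenQuotientMap_polygonSpace a).isOpenMap

end Quotients

/-! ### Polygon spaces are smooth manifolds -/

/-- A surjective linear map is, up to an isomorphism of its domain, a projection. -/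
theorem exists_equiv_prod_of_surjective {V T : Type*} [NormedAddCommGroup V] [NormedSpace ℝ V]
    [FiniteDimensional ℝ V] [NormedAddCommGroup T] [NormedSpace ℝ T] [FiniteDimensional ℝ T]
    {f : V →L[ℝ] T} (hf : Function.Surjective f) {k : ℕ}
    (hk : Module.finrank ℝ T + k = Module.finrank ℝ V) :
    ∃ L : V ≃L[ℝ] T × EuclideanSpace ℝ (Fin k), ∀ v, (L v).1 = f v := by
  have h1 := LinearMap.finrank_range_add_finrank_ker (f : V →ₗ[ℝ] T)
  rw [LinearMap.range_eq_top.2 hf, finrank_top] at h1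
  have h2 : Module.finrank ℝ (LinearMap.ker (f : V →ₗ[ℝ] T)) =
      Module.finrank ℝ (EuclideanSpace ℝ (Fin k)) := by
    rw [finrank_euclideanSpace_fin]
    omega
  let e := LinearEquiv.ofFinrankEq _ _ h2
  obtain ⟨p, hp⟩ := LinearMap.exists_leftInverse_of_injective
    (LinearMap.ker (f : V →ₗ[ℝ] T)).subtype (Submodule.ker_subtype _)
  let g : V →ₗ[ℝ] T × EuclideanSpace ℝ (Fin k) :=
    (f : V →ₗ[ℝ] T).prod (e.toLinearMap ∘ₗ p)
  have hg : Function.Injective g := by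
    refine (injective_iff_map_eq_zero g).2 fun v hv => ?_
    have h3 : f v = 0 := congrArg Prod.fst hv
    have h4 : e (p v) = 0 := congrArg Prod.snd hv
    rw [LinearEquiv.map_eq_zero_iff] at h4
    have h5 := LinearMap.congr_fun hp ⟨v, h3⟩
    simp only [LinearMap.comp_apply, Submodule.subtype_apply, h4, LinearMap.id_apply] at h5
    exact (congrArg Subtype.val h5).symm
  have h6 : Module.finrank ℝ V = Module.finrank ℝ (T × EuclideanSpace ℝ (Fin k)) := by
    rw [Module.finrank_prod, finrank_euclideanSpace_fin, hk]
  exact ⟨(LinearMap.linearEquivOfInjective g hg h6).toContinuousLinearEquiv, fun v => rfl⟩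

section Charts

variable {n : ℕ}

/-- The equations for the chains whose `i`-th vector lies in the plane spanned by the first two
vectors of the standard basis. -/
def sliceMap (a : Fin (n + 1) → ℝ) (i : Fin n) (z : Fin n → EuclideanSpace ℝ (Fin 3)) :
    (Fin n → ℝ) × EuclideanSpace ℝ (Fin 3) × ℝ :=
  (fun j => ‖z j‖ ^ 2 - 1, ∑ j, a j.castSucc • z j - a (Fin.last n) • e₁ 3, z i 2)

theorem sliceMap_eq_zero_iff {a : Fin (n + 1) → ℝ} {i : Fin n}
    {z : Fin n → EuclideanSpace ℝ (Fin 3)} :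
    sliceMap a i z = 0 ↔ z ∈ chains 3 a ∧ z i 2 = 0 := by
  have h : ∀ j, ‖z j‖ ^ 2 - 1 = 0 ↔ ‖z j‖ = 1 := fun j => by
    rw [sub_eq_zero, pow_eq_one_iff_of_nonneg (norm_nonneg _) two_ne_zero]
  simp only [sliceMap, chains, Prod.ext_iff, funext_iff, Prod.fst_zero, Prod.snd_zero,
    Pi.zero_apply, h, Set.mem_ofPred_eq, and_assoc, sub_eq_zero]

theorem contDiff_sliceMap (a : Fin (n + 1) → ℝ) (i : Fin n) : ContDiff ℝ ∞ (sliceMap a i) := by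
  refine ContDiff.prodMk (contDiff_pi.2 fun j => ?_) (ContDiff.prodMk ?_ ?_)
  · have h1 : ContDiff ℝ ∞ fun z : Fin n → EuclideanSpace ℝ (Fin 3) => z j := by fun_prop
    exact (h1.norm_sq ℝ).sub contDiff_const
  · fun_prop
  · fun_prop

/-- The derivative of `sliceMap`. -/
def sliceDeriv (a : Fin (n + 1) → ℝ) (i : Fin n) (z : Fin n → EuclideanSpace ℝ (Fin 3)) :
    (Fin n → EuclideanSpace ℝ (Fin 3)) →L[ℝ]
      (Fin n → ℝ) × EuclideanSpace ℝ (Fin 3) × ℝ :=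
  (ContinuousLinearMap.pi fun j => (2 : ℝ) • (innerSL ℝ (z j)).comp
      (ContinuousLinearMap.proj (R := ℝ) j)).prod
    ((∑ j, a j.castSucc • ContinuousLinearMap.proj (R := ℝ) j).prod
      ((EuclideanSpace.proj (𝕜 := ℝ) 2).comp (ContinuousLinearMap.proj (R := ℝ) i)))

theorem sliceDeriv_apply (a : Fin (n + 1) → ℝ) (i : Fin n)
    (z v : Fin n → EuclideanSpace ℝ (Fin 3)) :
    sliceDeriv a i z v =
      (fun j => 2 * inner ℝ (z j) (v j), ∑ j, a j.castSucc • v j, v i 2) := by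
  ext <;> simp [sliceDeriv]

theorem hasFDerivAt_sliceMap (a : Fin (n + 1) → ℝ) (i : Fin n)
    (z : Fin n → EuclideanSpace ℝ (Fin 3)) : HasFDerivAt (sliceMap a i) (sliceDeriv a i z) z := by
  refine HasFDerivAt.prodMk (hasFDerivAt_pi.2 fun j => ?_) (HasFDerivAt.prodMk ?_ ?_)
  · have h1 := (ContinuousLinearMap.proj (R := ℝ)
      (φ := fun _ : Fin n => EuclideanSpace ℝ (Fin 3)) j).hasFDerivAt (x := z)
    convert! h1.norm_sq.sub_const 1 using 1
    ext v
    simp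
  · refine HasFDerivAt.sub_const _ (HasFDerivAt.fun_sum fun j _ => ?_)
    exact (ContinuousLinearMap.proj (R := ℝ)
      (φ := fun _ : Fin n => EuclideanSpace ℝ (Fin 3)) j).hasFDerivAt.const_smul (a j.castSucc)
  · exact ((EuclideanSpace.proj (𝕜 := ℝ) 2).comp (ContinuousLinearMap.proj (R := ℝ)
      (φ := fun _ : Fin n => EuclideanSpace ℝ (Fin 3)) i)).hasFDerivAt

/-- The infinitesimal rotation about the first axis. -/
def quarterTurn : EuclideanSpace ℝ (Fin 3) →ₗ[ℝ] EuclideanSpace ℝ (Fin 3) where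
  toFun x := !₂[0, -x 2, x 1]
  map_add' x y := by apply ext_three <;> simp [add_comm]
  map_smul' r x := by apply ext_three <;> simp

theorem quarterTurn_apply (x : EuclideanSpace ℝ (Fin 3)) : quarterTurn x = !₂[0, -x 2, x 1] := rfl

theorem inner_quarterTurn (x : EuclideanSpace ℝ (Fin 3)) : inner ℝ x (quarterTurn x) = (0 : ℝ) := by
  simp [quarterTurn_apply, inner_three]
  ring

/-- The three values are attained by successive corrections. Multiples of the `z j` give the
derivatives of the lengths. The projections of a common vector `u` adjust the sum without changing
the lengths, by injectivity, hence surjectivity, of the sum of projections. An infinitesimal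
rotation changes neither of these, but moves `z i` out of the plane because `z i 1 ≠ 0`. -/
theorem sliceDeriv_surjective {a : Fin (n + 1) → ℝ} (ha : a ∈ weaklyGeneric n) {i : Fin n}
    {z : Fin n → EuclideanSpace ℝ (Fin 3)} (hz : z ∈ chains 3 a) (hi : z i 1 ≠ 0) :
    Function.Surjective (sliceDeriv a i z) := by
  let M : EuclideanSpace ℝ (Fin 3) →ₗ[ℝ] EuclideanSpace ℝ (Fin 3) :=
    ∑ j, a j.castSucc • (LinearMap.id - (innerSL ℝ (z j)).toLinearMap.smulRight (z j))
  have hM : ∀ u, M u = ∑ j, a j.castSucc • (u - (inner ℝ (z j) u : ℝ) • z j) := fun u => by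
    simp [M]
  have hMs : Function.Surjective M := LinearMap.injective_iff_surjective.1
    ((injective_iff_map_eq_zero M).2 fun u hu =>
      eq_zero_of_sum_projection_eq_zero ha hz ((hM u).symm.trans hu))
  rintro ⟨r, p, s⟩
  obtain ⟨u, hu⟩ := hMs (p - ∑ j, a j.castSucc • (r j / 2) • z j)
  let v₀ : Fin n → EuclideanSpace ℝ (Fin 3) := fun j =>
    (r j / 2) • z j + (u - (inner ℝ (z j) u : ℝ) • z j)
  refine ⟨fun j => v₀ j + ((s - v₀ i 2) / z i 1) • quarterTurn (z j), ?_⟩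
  rw [sliceDeriv_apply, Prod.mk.injEq, Prod.mk.injEq]
  refine ⟨funext fun j => ?_, ?_, ?_⟩
  · simp only [v₀, inner_add_right, inner_sub_right, inner_smul_right, inner_quarterTurn,
      real_inner_self_eq_norm_sq, hz.1 j]
    ring
  · have h1 : ∑ j, a j.castSucc • quarterTurn (z j) = 0 := by
      simp only [← map_smul, ← map_sum, hz.2]
      apply ext_three <;> simp [quarterTurn_apply]
    rw [hM] at hu
    simp only [v₀, smul_add, Finset.sum_add_distrib, hu, smul_comm _ ((s - _) / z i 1),
      ← Finset.smul_sum, h1]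
    simp
  · simp only [PiLp.add_apply, PiLp.smul_apply, quarterTurn_apply, Matrix.cons_val, smul_eq_mul]
    field_simp
    ring

/-- If all vectors were on the axis, `e₁ 3` would be killed by the sum of projections, against its
injectivity. An off-axis vector has trivial stabilizer, so this is where freeness of the action
enters. -/
theorem exists_axisDistSq_pos {a : Fin (n + 1) → ℝ} (ha : a ∈ weaklyGeneric n)
    {z : Fin n → EuclideanSpace ℝ (Fin 3)} (hz : z ∈ chains 3 a) : ∃ i, 0 < axisDistSq i z := by
  by_contra! h
  have h1 : e₁ 3 = 0 := eq_zero_of_sum_projection_eq_zero ha hz <|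
    Finset.sum_eq_zero fun j _ => by
      have h2 := h j
      have h3 := norm_sq_three (z j)
      simp only [axisDistSq] at h2
      have h4 : z j 1 = 0 := by nlinarith [sq_nonneg (z j 1), sq_nonneg (z j 2)]
      have h5 : z j 2 = 0 := by nlinarith [sq_nonneg (z j 1), sq_nonneg (z j 2)]
      rw [hz.1 j, h4, h5] at h3
      have h6 : e₁ 3 - (inner ℝ (z j) (e₁ 3) : ℝ) • z j = 0 := by
        apply ext_three <;> simp [inner_three, h4, h5]
        linarith
      rw [h6, smul_zero]
  have h2 := congrArg norm h1
  rw [norm_e₁, norm_zero] at h2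
  exact one_ne_zero h2

theorem finrank_sliceMap_domain (n : ℕ) :
    Module.finrank ℝ (Fin n → EuclideanSpace ℝ (Fin 3)) = 3 * n := by
  simp [Module.finrank_pi_fintype, mul_comm]

theorem finrank_sliceMap_codomain (n : ℕ) :
    Module.finrank ℝ ((Fin n → ℝ) × EuclideanSpace ℝ (Fin 3) × ℝ) = n + 4 := by
  simp [Module.finrank_prod]

/-- Coordinates of the ambient space around a point of a slice, in which the slice is
a coordinate subspace. -/
theorem exists_slice_coordinates {a : Fin (n + 1) → ℝ} (ha : a ∈ weaklyGeneric n) {i : Fin n}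
    {z : Fin n → EuclideanSpace ℝ (Fin 3)} (hz : z ∈ chains 3 a) (hi : 0 < z i 1) {k : ℕ}
    (hk : n + 4 + k = 3 * n) :
    ∃ (e : OpenPartialHomeomorph (Fin n → EuclideanSpace ℝ (Fin 3))
        (((Fin n → ℝ) × EuclideanSpace ℝ (Fin 3) × ℝ) × EuclideanSpace ℝ (Fin k))),
      z ∈ e.source ∧ (∀ y ∈ e.source, 0 < y i 1) ∧ (∀ y, (e y).1 = sliceMap a i y) ∧
      (ContDiff ℝ ∞ fun y => (e y).2) ∧ ContDiffOn ℝ ∞ e.symm e.target := by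
  obtain ⟨L, hL⟩ := exists_equiv_prod_of_surjective (k := k)
    (sliceDeriv_surjective ha hz hi.ne') (by
      rw [finrank_sliceMap_domain, finrank_sliceMap_codomain, hk])
  have h1 : ContDiff ℝ ∞ fun y => (sliceMap a i y, (L y).2) :=
    (contDiff_sliceMap a i).prodMk (contDiff_snd.comp L.contDiff)
  -- The first component of `L` is the derivative of `sliceMap`, so completing `sliceMap` by the
  -- linear second component gives a map with derivative `L`.
  have h2 : HasFDerivAt (fun y => (sliceMap a i y, (L y).2))
      (L : (Fin n → EuclideanSpace ℝ (Fin 3)) →L[ℝ] _) z := by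
    have h3 := (hasFDerivAt_sliceMap a i z).prodMk
      (((ContinuousLinearMap.snd ℝ _ _).comp L.toContinuousLinearMap).hasFDerivAt (x := z))
    convert! h3 using 1
    refine ContinuousLinearMap.ext fun v => Prod.ext (hL v) rfl
  obtain ⟨e, hz', he, he', hes⟩ := exists_smooth_inverse
    (isOpen_lt continuous_const (by fun_prop) :
      IsOpen {y : Fin n → EuclideanSpace ℝ (Fin 3) | 0 < y i 1}) h1.contDiffOn hi h2
  refine ⟨e, hz', he, fun y => by rw [he'], ?_, hes⟩
  simp only [he']
  exact contDiff_snd.comp L.contDiff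

theorem rotationInvariant_align {a : Fin (n + 1) → ℝ} {x y : chains 3 a}
    (h : (orbitSetoid 3 (chains 3 a)) x y) (i : Fin n) :
    align i x.1 = align i y.1 ∧ axisDistSq i x.1 = axisDistSq i y.1 := by
  obtain ⟨R, hR : R • y.1 = x.1⟩ := h
  rw [← hR, align_smul, axisDistSq_smul]
  exact ⟨rfl, rfl⟩

theorem exists_polygonSpace_eq_align {a : Fin (n + 1) → ℝ} {i : Fin n} (z : chains 3 a)
    (h : 0 < axisDistSq i z.1) : ∃ hz : align i z.1 ∈ chains 3 a,
      Quotient.mk (orbitSetoid 3 (chains 3 a)) ⟨align i z.1, hz⟩ = Quotient.mk _ z := by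
  obtain ⟨R, hR⟩ := exists_smul_eq_align h
  exact ⟨hR ▸ smul_mem_chains R z.2, Quotient.sound ⟨R, hR⟩⟩

/-- Slice coordinates define a smooth chart of the polygon space. -/
theorem exists_polygonSpace_chart {a : Fin (n + 1) → ℝ} {i : Fin n} {k : ℕ} (z₀ : chains 3 a)
    (hz₀ : z₀.1 i 2 = 0)
    (e : OpenPartialHomeomorph (Fin n → EuclideanSpace ℝ (Fin 3))
        (((Fin n → ℝ) × EuclideanSpace ℝ (Fin 3) × ℝ) × EuclideanSpace ℝ (Fin k)))
    (hze : z₀.1 ∈ e.source) (he0 : ∀ y ∈ e.source, 0 < y i 1)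
    (he1 : ∀ y, (e y).1 = sliceMap a i y) (he2 : ContDiff ℝ ∞ fun y => (e y).2)
    (hes : ContDiffOn ℝ ∞ e.symm e.target) :
    ∃ φ : OpenPartialHomeomorph (PolygonSpace 3 a) (EuclideanSpace ℝ (Fin k)),
      IsSmoothChart φ ∧ Quotient.mk _ z₀ ∈ φ.source := by
  classical
  let q : chains 3 a → PolygonSpace 3 a := Quotient.mk _
  have hq : IsOpenQuotientMap q := isOpenQuotientMap_polygonSpace a
  let A : Set (Fin n → EuclideanSpace ℝ (Fin 3)) :=
    {z | 0 < axisDistSq i z} ∩ align i ⁻¹' e.source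
  have hA : IsOpen A := (contDiffOn_align i).continuousOn.isOpen_inter_preimage
    (isOpen_axisDistSq_pos i) e.open_source
  let ψ : (Fin n → EuclideanSpace ℝ (Fin 3)) → EuclideanSpace ℝ (Fin k) :=
    fun z => (e (align i z)).2
  have hψ : ContDiffOn ℝ ∞ ψ A :=
    he2.comp_contDiffOn ((contDiffOn_align i).mono Set.inter_subset_left)
  -- In the coordinates `e` the slice is the zero set of the first component; `T` parametrizes it,
  -- and `σ` below is a section of the orbit map over it, with the irrelevant value `z₀` outside
  -- `T`.
  let T : Set (EuclideanSpace ℝ (Fin k)) := (fun y => (0, y)) ⁻¹' e.target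
  have hT : IsOpen T := e.open_target.preimage (Continuous.prodMk_right _)
  have hσ : ∀ y ∈ T, e.symm (0, y) ∈ chains 3 a ∧ e.symm (0, y) i 2 = 0 := fun y hy => by
    rw [← sliceMap_eq_zero_iff, ← he1, e.right_inv hy]
  let σ : EuclideanSpace ℝ (Fin k) → chains 3 a := fun y =>
    if h : y ∈ T then ⟨e.symm (0, y), (hσ y h).1⟩ else z₀
  have hσ' : ∀ y ∈ T, (σ y).1 = e.symm (0, y) := fun y hy => by simp only [σ, dif_pos hy]
  have hσc : ContDiffOn ℝ ∞ (fun y => e.symm (0, y)) T :=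
    hes.comp (ContDiff.contDiffOn (by fun_prop)) fun y hy => hy
  have halign : ∀ y ∈ T, align i (σ y).1 = e.symm (0, y) := fun y hy => by
    rw [hσ' y hy]
    exact align_eq_self (he0 _ (e.map_target hy)) (hσ y hy).2
  have hσA : ∀ y ∈ T, (σ y).1 ∈ A := fun y hy => by
    refine ⟨?_, ?_⟩
    · have h1 := he0 _ (e.map_target hy)
      rw [← hσ' y hy] at h1
      simp only [Set.mem_ofPred_eq, axisDistSq]
      positivity
    · rw [Set.mem_preimage, halign y hy]
      exact e.map_target hy
  have hψσ : ∀ y ∈ T, ψ (σ y).1 = y := fun y hy => by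
    simp only [ψ, halign y hy]
    rw [e.right_inv hy]
  have heψ : ∀ z : chains 3 a, z.1 ∈ A → (0, ψ z.1) = e (align i z.1) := fun z hz => by
    obtain ⟨hz', -⟩ := exists_polygonSpace_eq_align z hz.1
    refine Prod.ext ?_ rfl
    rw [he1]
    exact (sliceMap_eq_zero_iff.2 ⟨hz', align_apply_self_two i _⟩).symm
  have hψT : ∀ z : chains 3 a, z.1 ∈ A → ψ z.1 ∈ T := fun z hz => by
    change (0, ψ z.1) ∈ e.target
    rw [heψ z hz]
    exact e.map_source hz.2
  have hσψ : ∀ z : chains 3 a, z.1 ∈ A → q (σ (ψ z.1)) = q z := fun z hz => by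
    obtain ⟨hz', h⟩ := exists_polygonSpace_eq_align z hz.1
    refine Eq.trans (congrArg q (Subtype.ext ?_)) h
    rw [hσ' _ (hψT z hz), heψ z hz, e.left_inv hz.2]
  let φ : OpenPartialHomeomorph (PolygonSpace 3 a) (EuclideanSpace ℝ (Fin k)) :=
    { toFun := Quotient.lift (fun z : chains 3 a => ψ z.1) fun x y h => by
        simp only [ψ, (rotationInvariant_align h i).1]
      invFun := fun y => q (σ y)
      source := {x | Quotient.lift (fun z : chains 3 a => z.1 ∈ A) (fun x y h => by
        simp only [A, Set.mem_inter_iff, Set.mem_preimage, Set.mem_ofPred_eq,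
          rotationInvariant_align h i]) x}
      target := T
      map_source' := by
        rintro ⟨z⟩ hz
        exact hψT z hz
      map_target' := fun y hy => hσA y hy
      left_inv' := by
        rintro ⟨z⟩ hz
        exact hσψ z hz
      right_inv' := fun y hy => hψσ y hy
      open_source := hq.isQuotientMap.isOpen_preimage.1 (hA.preimage continuous_subtype_val)
      open_target := hT
      continuousOn_toFun := by
        rintro ⟨z⟩ hz
        refine ContinuousAt.continuousWithinAt ((hq.continuousAt_comp_iff (x := z)).1 ?_)
        exact ContinuousAt.comp (f := Subtype.val)
          (hψ.continuousOn.continuousAt (hA.mem_nhds hz)) continuous_subtype_val.continuousAt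
      continuousOn_invFun := by
        refine hq.continuous.comp_continuousOn
          (Topology.IsInducing.subtypeVal.continuousOn_iff.2 ?_)
        exact hσc.continuousOn.congr hσ' }
  have hφq : ∀ z : chains 3 a, φ (q z) = ψ z.1 := fun z => rfl
  have hφs : ∀ z : chains 3 a, q z ∈ φ.source ↔ z.1 ∈ A := fun z => Iff.rfl
  refine ⟨φ, fun U f hU hUφ => ⟨fun hf => ?_, fun hf => ?_⟩, ?_⟩
  -- In the chart, `f` is the composition of a local ambient extension with the smooth section.
  · rintro _ ⟨x, hx, rfl⟩
    set y := φ x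
    have hy : y ∈ T := φ.map_source (hUφ hx)
    have hyx : q (σ y) = x := φ.left_inv (hUφ hx)
    obtain ⟨W, F, hW, hyW, hF, h⟩ := hf (σ y) (show q (σ y) ∈ U by rwa [hyx])
    have h1 : ContDiffOn ℝ ∞ (fun y => F (e.symm (0, y)))
        (T ∩ (fun y => e.symm (0, y)) ⁻¹' W) :=
      hF.comp (hσc.mono Set.inter_subset_left) fun y hy => hy.2
    have h2 : IsOpen (T ∩ (fun y => e.symm (0, y)) ⁻¹' W) :=
      hσc.continuousOn.isOpen_inter_preimage hT hW
    have h3 : y ∈ T ∩ (fun y => e.symm (0, y)) ⁻¹' W := ⟨hy, by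
      rw [Set.mem_preimage, ← hσ' y hy]
      exact hyW⟩
    refine (ContDiffAt.congr_of_eventuallyEq (h1.contDiffAt (h2.mem_nhds h3)) ?_).contDiffWithinAt
    filter_upwards [h2.mem_nhds h3] with y' hy'
    have h4 := h (σ y') (by rw [hσ' _ hy'.1]; exact hy'.2)
    rw [hσ' _ hy'.1] at h4
    exact h4
  -- Conversely, composing the chart expression with `ψ` gives an ambient extension, because
  -- aligning does not change the orbit.
  · intro z hz
    have hzA : z.1 ∈ A := (hφs z).1 (hUφ hz)
    have hφU : IsOpen (φ '' U) := φ.isOpen_image_of_subset_source hU hUφ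
    refine ⟨A ∩ ψ ⁻¹' (φ '' U), fun z => (f ∘ φ.symm) (ψ z),
      hψ.continuousOn.isOpen_inter_preimage hA hφU, ⟨hzA, q z, hz, rfl⟩,
      hf.comp (hψ.mono Set.inter_subset_left) fun y hy => hy.2, fun y hy => ?_⟩
    exact congrArg f (hσψ y hy.1).symm
  · rw [hφs]
    have h1 := he0 _ hze
    refine ⟨?_, ?_⟩
    · simp only [Set.mem_ofPred_eq, axisDistSq]
      positivity
    · rw [Set.mem_preimage, align_eq_self h1 hz₀]
      exact hze

theorem isSmoothManifold_polygonSpace {a : Fin (n + 2) → ℝ} (ha : a ∈ weaklyGeneric (n + 1)) :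
    IsSmoothManifold (2 * (n + 2 - 3)) (PolygonSpace 3 a) := by
  refine ⟨t2Space_polygonSpace a, secondCountableTopology_polygonSpace a, fun x => ?_⟩
  induction x using Quotient.inductionOn with | h z => ?_
  obtain ⟨i, hi⟩ := exists_axisDistSq_pos ha z.2
  obtain ⟨hz, h⟩ := exists_polygonSpace_eq_align z hi
  have h1 := align_apply_self_one hi
  -- Surjectivity gives `n + 5 ≤ 3 * (n + 1)`, so `n ≥ 1` and the natural subtraction in the
  -- dimension does not truncate.
  have hn := LinearMap.finrank_le_finrank_of_surjective
    (f := (sliceDeriv a i (align i z.1)).toLinearMap) (sliceDeriv_surjective ha hz h1.ne')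
  rw [finrank_sliceMap_domain, finrank_sliceMap_codomain] at hn
  obtain ⟨e, h2, h3, h4, h5, h6⟩ := exists_slice_coordinates ha hz h1
    (k := 2 * (n + 2 - 3)) (by omega)
  rw [← h]
  exact exists_polygonSpace_chart ⟨_, hz⟩ (align_apply_self_two i _) e h2 h3 h4 h5 h6

end Charts

/-! ### Entire functions giving the polar coordinates of the sphere -/

section PowerSeries

/-- A power series whose coefficients are bounded by those of the exponential function
is smooth. -/
theorem contDiff_of_hasSum {c : ℕ → ℝ} (hc : ∀ k, ‖c k‖ ≤ 1 / (k.factorial : ℝ)) {f : ℝ → ℝ}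
    (hf : ∀ x, HasSum (fun k => c k * x ^ k) (f x)) : ContDiff ℝ ∞ f := by
  have h1 : (FormalMultilinearSeries.ofScalars ℝ c).radius = ⊤ := by
    refine FormalMultilinearSeries.radius_eq_top_of_summable_norm _ fun r => ?_
    refine Summable.of_nonneg_of_le (fun k => by positivity) (fun k => ?_)
      (Real.summable_pow_div_factorial r)
    rw [FormalMultilinearSeries.ofScalars_norm, div_eq_inv_mul, ← one_div]
    gcongr
    exact hc k
  have h2 := (FormalMultilinearSeries.ofScalars ℝ c).hasFPowerSeriesOnBall (by simp [h1])
  have h3 : (FormalMultilinearSeries.ofScalars ℝ c).sum = f := by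
    funext x
    have h4 := FormalMultilinearSeries.ofScalars_sum_eq c x
    rw [FormalMultilinearSeries.ofScalarsSum] at h4
    rw [h4]
    simpa using (hf x).tsum_eq
  rw [h1, h3] at h2
  refine AnalyticOnNhd.contDiff fun x _ => h2.analyticAt_of_mem ?_
  simp

theorem summable_coeff_mul_pow {c : ℕ → ℝ} (hc : ∀ k, ‖c k‖ ≤ 1 / (k.factorial : ℝ)) (x : ℝ) :
    Summable fun k => c k * x ^ k := by
  refine Summable.of_norm_bounded (Real.summable_pow_div_factorial |x|) fun k => ?_
  rw [norm_mul, norm_pow, Real.norm_eq_abs x, div_eq_inv_mul, ← one_div]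
  gcongr
  exact hc k

theorem norm_neg_one_pow_div_factorial_le {k m : ℕ} (h : k ≤ m) :
    ‖(-1 : ℝ) ^ k / (m.factorial : ℝ)‖ ≤ 1 / (k.factorial : ℝ) := by
  rw [norm_div, norm_pow, norm_neg, norm_one, one_pow, Real.norm_natCast]
  gcongr

/-- The entire function with `cosSqrt (x ^ 2) = cos x`. -/
def cosSqrt (u : ℝ) : ℝ := ∑' k : ℕ, (-1 : ℝ) ^ k / ((2 * k).factorial : ℝ) * u ^ k

/-- The entire function with `sincSqrt (x ^ 2) * x = sin x`. -/
def sincSqrt (u : ℝ) : ℝ := ∑' k : ℕ, (-1 : ℝ) ^ k / ((2 * k + 1).factorial : ℝ) * u ^ k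

theorem hasSum_cosSqrt (u : ℝ) :
    HasSum (fun k : ℕ => (-1 : ℝ) ^ k / ((2 * k).factorial : ℝ) * u ^ k) (cosSqrt u) :=
  (summable_coeff_mul_pow (fun _ => norm_neg_one_pow_div_factorial_le (by omega)) u).hasSum

theorem hasSum_sincSqrt (u : ℝ) :
    HasSum (fun k : ℕ => (-1 : ℝ) ^ k / ((2 * k + 1).factorial : ℝ) * u ^ k) (sincSqrt u) :=
  (summable_coeff_mul_pow (fun _ => norm_neg_one_pow_div_factorial_le (by omega)) u).hasSum

theorem contDiff_cosSqrt : ContDiff ℝ ∞ cosSqrt :=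
  contDiff_of_hasSum (fun _ => norm_neg_one_pow_div_factorial_le (by omega)) hasSum_cosSqrt

theorem contDiff_sincSqrt : ContDiff ℝ ∞ sincSqrt :=
  contDiff_of_hasSum (fun _ => norm_neg_one_pow_div_factorial_le (by omega)) hasSum_sincSqrt

theorem cosSqrt_sq (x : ℝ) : cosSqrt (x ^ 2) = Real.cos x := by
  refine (hasSum_cosSqrt (x ^ 2)).unique ?_
  have h : (fun k : ℕ => (-1 : ℝ) ^ k / ((2 * k).factorial : ℝ) * (x ^ 2) ^ k) =
      fun k => (-1) ^ k * x ^ (2 * k) / ((2 * k).factorial : ℝ) := by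
    funext k
    rw [← pow_mul]
    ring
  rw [h]
  exact Real.hasSum_cos x

theorem sincSqrt_sq_mul (x : ℝ) : sincSqrt (x ^ 2) * x = Real.sin x := by
  refine ((hasSum_sincSqrt (x ^ 2)).mul_right x).unique ?_
  have h : (fun k : ℕ => (-1 : ℝ) ^ k / ((2 * k + 1).factorial : ℝ) * (x ^ 2) ^ k * x) =
      fun k => (-1) ^ k * x ^ (2 * k + 1) / ((2 * k + 1).factorial : ℝ) := by
    funext k
    rw [← pow_mul]
    ring
  rw [h]
  exact Real.hasSum_sin x

theorem sincSqrt_zero : sincSqrt 0 = 1 := by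
  refine (hasSum_sincSqrt 0).unique ?_
  convert hasSum_ite_eq 0 (1 : ℝ) using 2 with k
  rcases k with _ | k <;> simp

theorem sincSqrt_sq_pos {x : ℝ} (h0 : 0 ≤ x) (h1 : x < Real.pi) : 0 < sincSqrt (x ^ 2) := by
  rcases h0.eq_or_lt with rfl | h0
  · simp [sincSqrt_zero]
  · have h2 := Real.sin_pos_of_pos_of_lt_pi h0 h1
    rw [← sincSqrt_sq_mul] at h2
    exact pos_of_mul_pos_left h2 h0.le

/-- Differentiating `cosSqrt (x ^ 2) = cos x` determines the derivative at `x ^ 2` for `x ≠ 0`;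
continuity extends the formula to `0`. -/
theorem hasDerivAt_cosSqrt_zero : HasDerivAt cosSqrt (-(1 / 2)) 0 := by
  have h1 := (contDiff_cosSqrt.differentiable (by simp) 0).hasDerivAt
  have h2 : ∀ x, deriv cosSqrt (x ^ 2) * (2 * x) = -(sincSqrt (x ^ 2) * x) := fun x => by
    have h3 := (contDiff_cosSqrt.differentiable (by simp) (x ^ 2)).hasDerivAt.comp x
      (hasDerivAt_pow 2 x)
    have h4 : cosSqrt ∘ (fun x => x ^ 2) = Real.cos := funext cosSqrt_sq
    rw [h4] at h3
    rw [sincSqrt_sq_mul, (Real.hasDerivAt_cos x).unique h3]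
    simp
  have h3 : ∀ x ∈ ({0}ᶜ : Set ℝ), deriv cosSqrt (x ^ 2) = -(1 / 2) * sincSqrt (x ^ 2) :=
    fun x hx => by
      have := h2 x
      rw [Set.mem_compl_singleton_iff] at hx
      apply mul_right_cancel₀ hx
      linarith
  have h4 : Continuous fun x : ℝ => deriv cosSqrt (x ^ 2) :=
    (contDiff_cosSqrt.continuous_deriv (by simp)).comp (by fun_prop)
  have h5 : Continuous fun x : ℝ => -(1 / 2) * sincSqrt (x ^ 2) :=
    continuous_const.mul (contDiff_sincSqrt.continuous.comp (by fun_prop))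
  have h6 := Continuous.ext_on (dense_compl_singleton (0 : ℝ)) h4 h5 h3
  have h7 := congrFun h6 0
  simp only [ne_eq, OfNat.ofNat_ne_zero, not_false_eq_true, zero_pow, sincSqrt_zero,
    mul_one] at h7
  rwa [h7] at h1

/-- The square of the arc cosine extends smoothly across `1`. -/
theorem exists_smooth_arccos_sq : ∃ (W : Set ℝ) (κ : ℝ → ℝ), IsOpen W ∧ 1 ∈ W ∧
    ContDiffOn ℝ ∞ κ W ∧ ∀ x ∈ W, x ≤ 1 → κ x = Real.arccos x ^ 2 := by
  have h1 : HasFDerivAt cosSqrt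
      ((ContinuousLinearEquiv.unitsEquivAut ℝ (Units.mk0 (-(1 / 2) : ℝ) (by norm_num)) :
        ℝ ≃L[ℝ] ℝ) : ℝ →L[ℝ] ℝ) 0 := hasDerivAt_cosSqrt_zero.hasFDerivAt_equiv (by norm_num)
  obtain ⟨e, h0, -, he, hes⟩ := exists_smooth_inverse isOpen_univ contDiff_cosSqrt.contDiffOn
    (Set.mem_univ 0) h1
  have h2 : Continuous fun x => Real.arccos x ^ 2 := Real.continuous_arccos.pow 2
  have h3 : cosSqrt 0 = 1 := by simpa using cosSqrt_sq 0
  -- The function `κ` is a local inverse of `cosSqrt` near `1`. The preimage condition places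
  -- `arccos x ^ 2` where `e` is injective, and `x > -1` ensures `cos (arccos x) = x` for `x ≤ 1`.
  refine ⟨e.target ∩ ((fun x => Real.arccos x ^ 2) ⁻¹' e.source ∩ Set.Ioi (-1)), e.symm,
    e.open_target.inter ((e.open_source.preimage h2).inter isOpen_Ioi), ⟨?_, ?_, by norm_num⟩,
    hes.mono Set.inter_subset_left, fun x hx hx1 => ?_⟩
  · rw [← h3, ← he]
    exact e.map_source h0
  · simpa using h0
  · have h4 : e (Real.arccos x ^ 2) = x := by
      rw [he, cosSqrt_sq, Real.cos_arccos (le_of_lt hx.2.2) hx1]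
    conv_lhs => rw [← h4]
    exact e.left_inv hx.2.1

end PowerSeries

/-! ### The sphere as the union of two disks -/

section HalfSphere

/-- The sign of a half sphere. -/
def sideSign (s : Bool) : ℝ := if s then 1 else -1

theorem sideSign_mul_self (s : Bool) : sideSign s * sideSign s = 1 := by
  cases s <;> simp [sideSign]

theorem abs_sideSign_mul (s : Bool) (x : ℝ) : |sideSign s * x| = |x| := by
  cases s <;> simp [sideSign]

/-- The map of the unit disk onto a half sphere in polar coordinates. -/
def halfSphere (s : Bool) (v : EuclideanSpace ℝ (Fin 3)) : EuclideanSpace ℝ (Fin 3) :=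
  (sideSign s * cosSqrt ((Real.pi / 2 * ‖v‖) ^ 2)) • e₁ 3 +
    (Real.pi / 2 * sincSqrt ((Real.pi / 2 * ‖v‖) ^ 2)) • v

/-- The norm of `v` enters only through its square, so there is no singularity at the centre of the
disk. -/
theorem contDiff_halfSphere (s : Bool) : ContDiff ℝ ∞ (halfSphere s) := by
  have h1 : ContDiff ℝ ∞ fun v : EuclideanSpace ℝ (Fin 3) => (Real.pi / 2 * ‖v‖) ^ 2 := by
    simp only [mul_pow]
    exact contDiff_const.mul (contDiff_norm_sq ℝ)
  exact ((contDiff_const.mul (contDiff_cosSqrt.comp h1)).smul contDiff_const).add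
    ((contDiff_const.mul (contDiff_sincSqrt.comp h1)).smul contDiff_id)

theorem halfSphere_smul (s : Bool) (R : axisRotations 3) (v : EuclideanSpace ℝ (Fin 3)) :
    halfSphere s (R • v) = R • halfSphere s v := by
  have h : ∀ x : EuclideanSpace ℝ (Fin 3), R • x =
      (R : EuclideanSpace ℝ (Fin 3) ≃ₗ[ℝ] EuclideanSpace ℝ (Fin 3)) x := fun _ => rfl
  rw [halfSphere, norm_smul_rotation]
  conv_lhs => rw [← smul_e₁ R]
  simp only [halfSphere, h, map_add, map_smul]

theorem smul_rotation_zero (R : axisRotations 3) (v : EuclideanSpace ℝ (Fin 3)) :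
    (R • v) 0 = v 0 := by
  obtain ⟨c, s, -, h⟩ := exists_eq_turn R
  rw [h, turn_zero]

theorem norm_sq_smul_e₁_add (x y : ℝ) {v : EuclideanSpace ℝ (Fin 3)} (hv : v 0 = 0) :
    ‖x • e₁ 3 + y • v‖ ^ 2 = x ^ 2 + y ^ 2 * ‖v‖ ^ 2 := by
  rw [norm_sq_three, norm_sq_three]
  simp [hv]
  ring

theorem norm_halfSphere (s : Bool) {v : EuclideanSpace ℝ (Fin 3)} (hv : v 0 = 0) :
    ‖halfSphere s v‖ = 1 := by
  have h1 : ‖halfSphere s v‖ ^ 2 = 1 := by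
    rw [halfSphere, norm_sq_smul_e₁_add _ _ hv, cosSqrt_sq, ← mul_pow,
      mul_right_comm, mul_comm (Real.pi / 2 * ‖v‖), sincSqrt_sq_mul, mul_pow, sq (sideSign s),
      sideSign_mul_self, one_mul, Real.cos_sq_add_sin_sq]
  exact (sq_eq_sq₀ (norm_nonneg _) zero_le_one).1 (by simpa using h1)

theorem halfSphere_zero (s : Bool) {v : EuclideanSpace ℝ (Fin 3)} (hv : v 0 = 0) :
    halfSphere s v 0 = sideSign s * Real.cos (Real.pi / 2 * ‖v‖) := by
  simp [halfSphere, hv, cosSqrt_sq]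

/-- On the unit circle the axial component is `± cos (π / 2) = 0`, so the two hemispheres agree
there. -/
theorem halfSphere_eq_of_norm_eq_one (s s' : Bool) {v : EuclideanSpace ℝ (Fin 3)}
    (hv : ‖v‖ = 1) : halfSphere s v = halfSphere s' v := by
  simp [halfSphere, hv, cosSqrt_sq]

theorem pi_half_mul_mem {r : ℝ} (h0 : 0 ≤ r) (h1 : r ≤ 1) :
    Real.pi / 2 * r ∈ Set.Icc 0 (Real.pi / 2) := by
  have := Real.pi_pos
  constructor
  · positivity
  · nlinarith

theorem sincSqrt_pos_of_mem {x : ℝ} (h : x ∈ Set.Icc 0 (Real.pi / 2)) : 0 < sincSqrt (x ^ 2) :=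
  sincSqrt_sq_pos h.1 (h.2.trans_lt (by linarith [Real.pi_pos]))

/-- The half spheres only meet along their boundaries. -/
theorem halfSphere_injective {s s' : Bool} {v v' : EuclideanSpace ℝ (Fin 3)}
    (hv : v 0 = 0) (hv1 : ‖v‖ ≤ 1) (hv' : v' 0 = 0) (hv1' : ‖v'‖ ≤ 1)
    (h : halfSphere s v = halfSphere s' v') : v = v' ∧ (s = s' ∨ ‖v‖ = 1) := by
  have hr := pi_half_mul_mem (norm_nonneg v) hv1
  have hr' := pi_half_mul_mem (norm_nonneg v') hv1'
  have h0 := congrArg (fun p : EuclideanSpace ℝ (Fin 3) => p 0) h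
  simp only [halfSphere_zero _ hv, halfSphere_zero _ hv'] at h0
  have hc : ∀ {x}, x ∈ Set.Icc 0 (Real.pi / 2) → 0 ≤ Real.cos x := fun hx =>
    Real.cos_nonneg_of_mem_Icc ⟨by linarith [hx.1, Real.pi_pos], hx.2⟩
  have h1 : Real.cos (Real.pi / 2 * ‖v‖) = Real.cos (Real.pi / 2 * ‖v'‖) := by
    have h2 := congrArg abs h0
    rwa [abs_sideSign_mul, abs_sideSign_mul, abs_of_nonneg (hc hr), abs_of_nonneg (hc hr')] at h2
  have h2 : Real.pi / 2 * ‖v‖ = Real.pi / 2 * ‖v'‖ :=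
    Real.injOn_cos ⟨hr.1, by linarith [hr.2, Real.pi_pos]⟩
      ⟨hr'.1, by linarith [hr'.2, Real.pi_pos]⟩ h1
  have h3 : Real.pi / 2 * sincSqrt ((Real.pi / 2 * ‖v‖) ^ 2) ≠ 0 :=
    (mul_pos (by positivity) (sincSqrt_pos_of_mem hr)).ne'
  refine ⟨?_, ?_⟩
  · simp only [halfSphere, cosSqrt_sq] at h
    rw [h0, ← h2] at h
    exact smul_right_injective _ h3 (add_left_cancel h)
  -- With opposite signs the common height must vanish, which puts the point on the equator.
  · by_contra! h4
    have h5 : sideSign s = -sideSign s' := by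
      have := h4.1
      cases s <;> cases s' <;> simp_all [sideSign]
    have h6 : Real.cos (Real.pi / 2 * ‖v‖) = 0 := by
      rw [h5, ← h1] at h0
      have h7 : sideSign s' * Real.cos (Real.pi / 2 * ‖v‖) = 0 := by linarith
      refine (mul_eq_zero.1 h7).resolve_left fun h8 => ?_
      have := sideSign_mul_self s'
      simp [h8] at this
    have h7 := Real.injOn_cos ⟨hr.1, by linarith [hr.2, Real.pi_pos]⟩
      ⟨by positivity, by linarith [Real.pi_pos]⟩ (h6.trans Real.cos_pi_div_two.symm)
    have h8 : Real.pi / 2 ≠ 0 := by positivity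
    exact h4.2 (mul_left_cancel₀ h8 (h7.trans (mul_one _).symm))

/-- The point of the disk over a point `p` of a half sphere, where `u` is the square of the
distance from the pole to `p`. -/
def diskPoint (u : ℝ) (p : EuclideanSpace ℝ (Fin 3)) : EuclideanSpace ℝ (Fin 3) :=
  (Real.pi / 2 * sincSqrt u)⁻¹ • (p - p 0 • e₁ 3)

/-- With `θ` the angle from the pole, the part of `p` orthogonal to the axis has length `sin θ =
sincSqrt (θ ^ 2) * θ`; the rescaling turns it into a vector of length `θ / (π / 2)`. -/
theorem diskPoint_spec {s : Bool} {p : EuclideanSpace ℝ (Fin 3)} (hp : ‖p‖ = 1)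
    (hs : 0 ≤ sideSign s * p 0) :
    diskPoint (Real.arccos (sideSign s * p 0) ^ 2) p 0 = 0 ∧
    ‖diskPoint (Real.arccos (sideSign s * p 0) ^ 2) p‖ ≤ 1 ∧
    halfSphere s (diskPoint (Real.arccos (sideSign s * p 0) ^ 2) p) = p := by
  set x := sideSign s * p 0 with hx
  have hpx : p 0 = sideSign s * x := by rw [hx, ← mul_assoc, sideSign_mul_self, one_mul]
  have hx2 : x ^ 2 = p 0 ^ 2 := by rw [hx, mul_pow, sq (sideSign s), sideSign_mul_self, one_mul]
  set y := p - p 0 • e₁ 3 with hy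
  have hy0 : y 0 = 0 := by simp [hy]
  have hpy : p = p 0 • e₁ 3 + (1 : ℝ) • y := by simp [hy]
  have hy2 : ‖y‖ ^ 2 = 1 - x ^ 2 := by
    have h1 := norm_sq_smul_e₁_add (p 0) 1 hy0
    rw [← hpy, hp] at h1
    rw [hx2]
    linarith
  have hx1 : x ≤ 1 := by nlinarith [sq_nonneg ‖y‖]
  set θ := Real.arccos x
  have hcos : Real.cos θ = x := Real.cos_arccos (by linarith) hx1
  have hθ : θ ∈ Set.Icc 0 (Real.pi / 2) := ⟨Real.arccos_nonneg x, Real.arccos_le_pi_div_two.2 hs⟩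
  have hsin : Real.sin θ = ‖y‖ := by
    rw [Real.sin_arccos, ← hy2, Real.sqrt_sq (norm_nonneg _)]
  have hk := sincSqrt_pos_of_mem hθ
  have hpi := Real.pi_pos
  have hnorm : Real.pi / 2 * ‖diskPoint (θ ^ 2) p‖ = θ := by
    rw [diskPoint, norm_smul, norm_inv, Real.norm_eq_abs, abs_of_pos (by positivity), ← hy, ← hsin,
      ← sincSqrt_sq_mul θ]
    field_simp
  refine ⟨?_, ?_, ?_⟩
  · rw [diskPoint, PiLp.smul_apply, ← hy, hy0, smul_zero]
  · have h2 := hθ.2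
    rw [← hnorm] at h2
    by_contra! h3
    nlinarith
  · rw [halfSphere, hnorm, diskPoint, smul_inv_smul₀ (by positivity), cosSqrt_sq, hcos, ← hpx]
    simp

theorem halfSphere_smul_unit (s : Bool) {r : ℝ} {v : EuclideanSpace ℝ (Fin 3)}
    (hr : 0 ≤ r) (hv : ‖v‖ = 1) : halfSphere s (r • v) =
      (sideSign s * Real.cos (Real.pi / 2 * r)) • e₁ 3 + Real.sin (Real.pi / 2 * r) • v := by
  rw [halfSphere, norm_smul, hv, mul_one, Real.norm_eq_abs, abs_of_nonneg hr, cosSqrt_sq,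
    smul_smul, mul_right_comm, mul_comm (Real.pi / 2 * r), sincSqrt_sq_mul]

/-- The maps onto the half spheres in the coordinates of the bicollar. -/
theorem halfSphere_bicollar {t : ℝ} (ht : |t| < 1) {v : EuclideanSpace ℝ (Fin 3)}
    (hv : ‖v‖ = 1) : halfSphere (decide (0 ≤ t)) ((1 - |t|) • v) =
      Real.sin (Real.pi / 2 * t) • e₁ 3 + Real.cos (Real.pi / 2 * t) • v := by
  -- Complementary angles replace `1 - |t|` by `|t|`; the sign of the side then absorbs the absolute
  -- value in the odd sine, and the even cosine ignores it. This makes the radial collars fit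
  -- smoothly.
  rw [halfSphere_smul_unit _ (by linarith) hv, mul_sub, mul_one, Real.cos_pi_div_two_sub,
    Real.sin_pi_div_two_sub]
  rcases le_or_gt 0 t with h | h
  · simp [sideSign, h, abs_of_nonneg h]
  · simp [sideSign, not_le.2 h, abs_of_neg h]

end HalfSphere

/-! ### The double of the disk bundle is the sphere bundle -/

section Double

variable {n : ℕ} {b : Fin (n + 1) → ℝ}

/-- The inclusion of a copy of `D² × 𝒞` as half of `S² × 𝒞`. -/
def halfMap (s : Bool) (p : diskTimesChains b) : sphereTimesChains b :=
  ⟨(halfSphere s p.1.1, p.1.2), norm_halfSphere s p.2.1, p.2.2.2⟩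

theorem smoothAt_halfMap (s : Bool) (p : diskTimesChains b) :
    SmoothAt (fun p : diskTimesChains b => (halfMap s p).1) p := by
  refine SmoothAt.of_contDiff (F := fun p : EuclideanSpace ℝ (Fin 3) ×
    (Fin n → EuclideanSpace ℝ (Fin 3)) => (halfSphere s p.1, p.2)) ?_ p
  exact ((contDiff_halfSphere s).comp contDiff_fst).prodMk contDiff_snd

theorem halfMap_rel (s : Bool) (p q : diskTimesChains b)
    (h : (orbitSetoid 3 (diskTimesChains b)) p q) :
    (orbitSetoid 3 (sphereTimesChains b)) (halfMap s p) (halfMap s q) := by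
  obtain ⟨R, hR : R • q.1 = p.1⟩ := h
  have h1 : R • q.1.1 = p.1.1 := congrArg Prod.fst hR
  have h2 : R • q.1.2 = p.1.2 := congrArg Prod.snd hR
  refine orbitSetoid_iff.2 ⟨R, Prod.ext ?_ h2⟩
  change R • halfSphere s q.1.1 = halfSphere s p.1.1
  rw [← halfSphere_smul, h1]

/-- The inclusion of a copy of the disk bundle as half of the sphere bundle. -/
def halfBundle (s : Bool) : DiskBundle b → SphereBundle b :=
  Quotient.map (halfMap s) (halfMap_rel s)

theorem continuous_halfBundle (s : Bool) : Continuous (halfBundle (b := b) s) :=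
  (continuous_of_smoothAt (smoothAt_halfMap s)).quotient_map' (halfMap_rel s)

/-- The map from the double of the disk bundle to the sphere bundle. -/
def doubleMap : Double b → SphereBundle b :=
  Quotient.lift (s := doubleSetoid b) (fun x => halfBundle x.1 x.2) (by
    rintro ⟨s, x⟩ ⟨s', y⟩ ⟨hxy : x = y, h⟩
    subst hxy
    rcases h with h | ⟨p, hp, h⟩
    · obtain rfl : s = s' := h
      rfl
    · replace h : Quotient.mk _ p = x := h
      subst h
      exact congrArg (Quotient.mk _)
        (Subtype.ext (Prod.ext (halfSphere_eq_of_norm_eq_one s s' hp) rfl)))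

theorem doubleMap_incl (s : Bool) (p : diskTimesChains b) :
    doubleMap (Double.incl s (Quotient.mk _ p)) = Quotient.mk _ (halfMap s p) := rfl

theorem continuous_doubleMap : Continuous (doubleMap (b := b)) := by
  refine Continuous.quotient_lift ?_ _
  exact continuous_prod_of_discrete_left.2 fun s => continuous_halfBundle s

theorem doubleMap_injective : Function.Injective (doubleMap (b := b)) := by
  rintro ⟨s, ⟨p⟩⟩ ⟨s', ⟨p'⟩⟩ h
  obtain ⟨R, hR⟩ := orbitSetoid_iff.1 (Quotient.exact h)
  have h1 : halfSphere s' (R • p'.1.1) = halfSphere s p.1.1 := by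
    rw [halfSphere_smul]
    exact congrArg Prod.fst hR
  have h2 : R • p'.1.2 = p.1.2 := congrArg Prod.snd hR
  obtain ⟨h3, h4⟩ := halfSphere_injective p.2.1 p.2.2.1
    ((smul_rotation_zero R _).trans p'.2.1) ((norm_smul_rotation R _).trans_le p'.2.2.1) h1.symm
  refine Quotient.sound (s := doubleSetoid b) ⟨?_, h4.imp id fun h5 => ⟨p, h5, rfl⟩⟩
  exact Quotient.sound ⟨R, Prod.ext h3.symm h2⟩

theorem exists_side (p : EuclideanSpace ℝ (Fin 3)) : ∃ s, 0 ≤ sideSign s * p 0 := by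
  rcases le_total 0 (p 0) with h | h
  · exact ⟨true, by simpa [sideSign] using h⟩
  · exact ⟨false, by simpa [sideSign] using h⟩

theorem diskPoint_mem {s : Bool} {p : EuclideanSpace ℝ (Fin 3) ×
    (Fin n → EuclideanSpace ℝ (Fin 3))} (hp : p ∈ sphereTimesChains b)
    (hs : 0 ≤ sideSign s * p.1 0) :
    (diskPoint (Real.arccos (sideSign s * p.1 0) ^ 2) p.1, p.2) ∈ diskTimesChains b :=
  ⟨(diskPoint_spec hp.1 hs).1, (diskPoint_spec hp.1 hs).2.1, hp.2⟩

theorem doubleMap_diskPoint {s : Bool} {p : EuclideanSpace ℝ (Fin 3) ×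
    (Fin n → EuclideanSpace ℝ (Fin 3))} (hp : p ∈ sphereTimesChains b)
    (hs : 0 ≤ sideSign s * p.1 0) :
    doubleMap (Double.incl s (Quotient.mk _ ⟨_, diskPoint_mem hp hs⟩)) = Quotient.mk _ ⟨p, hp⟩ :=
  congrArg (Quotient.mk _) (Subtype.ext (Prod.ext (diskPoint_spec hp.1 hs).2.2 rfl))

theorem doubleMap_surjective : Function.Surjective (doubleMap (b := b)) := by
  rintro ⟨p⟩
  obtain ⟨s, hs⟩ := exists_side p.1.1
  exact ⟨_, doubleMap_diskPoint p.2 hs⟩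

theorem isCompact_diskTimesChains (b : Fin (n + 1) → ℝ) : IsCompact (diskTimesChains b) := by
  have h1 : diskTimesChains b = (Metric.closedBall 0 1 ×ˢ {z | ∀ i, ‖z i‖ = 1}) ∩
      {p : EuclideanSpace ℝ (Fin 3) × (Fin n → EuclideanSpace ℝ (Fin 3)) | p.1 0 = 0 ∧ ∑ i, b i.castSucc • p.2 i = b (Fin.last n) • e₁ 3} := by
    ext p
    simp only [diskTimesChains, chains, Set.mem_ofPred_eq, Set.mem_inter_iff, Set.mem_prod,
      mem_closedBall_zero_iff]
    tauto
  rw [h1]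
  refine ((isCompact_closedBall _ _).prod isCompact_unitVectors).inter_right (IsClosed.inter ?_ ?_)
  · exact isClosed_eq (by fun_prop) continuous_const
  · exact isClosed_eq (by fun_prop) continuous_const

instance : CompactSpace (DiskBundle b) :=
  have := isCompact_iff_compactSpace.1 (isCompact_diskTimesChains b)
  Quotient.compactSpace

instance : CompactSpace (Double b) :=
  inferInstanceAs (CompactSpace (Quotient (doubleSetoid b)))

/-- The coordinates of the bicollar on the sphere without the poles. -/
def collarPoint (p : EuclideanSpace ℝ (Fin 3) × (Fin n → EuclideanSpace ℝ (Fin 3))) :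
    ℝ × EuclideanSpace ℝ (Fin 3) × (Fin n → EuclideanSpace ℝ (Fin 3)) :=
  (2 / Real.pi * Real.arcsin (p.1 0), (√(1 - p.1 0 ^ 2))⁻¹ • (p.1 - p.1 0 • e₁ 3), p.2)

theorem contDiffOn_collarPoint : ContDiffOn ℝ ∞ (collarPoint (n := n)) {p | |p.1 0| < 1} := by
  have h1 : ContDiff ℝ ∞ fun p : EuclideanSpace ℝ (Fin 3) ×
      (Fin n → EuclideanSpace ℝ (Fin 3)) => p.1 0 := by fun_prop
  have h2 : ∀ p ∈ {p : EuclideanSpace ℝ (Fin 3) × (Fin n → EuclideanSpace ℝ (Fin 3)) |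
      |p.1 0| < 1}, 0 < 1 - p.1 0 ^ 2 := fun p hp => by
    have := (sq_lt_one_iff_abs_lt_one (p.1 0)).2 hp
    linarith
  refine ContDiffOn.prodMk (contDiffOn_const.mul ?_) (ContDiffOn.prodMk (ContDiffOn.fun_smul ?_ ?_)
    contDiffOn_snd)
  · intro p hp
    have h3 : -1 < p.1 0 ∧ p.1 0 < 1 := abs_lt.1 hp
    exact (ContDiffAt.comp p (Real.contDiffAt_arcsin h3.1.ne' h3.2.ne)
      h1.contDiffAt).contDiffWithinAt
  · refine ContDiffOn.inv (ContDiffOn.sqrt ?_ fun p hp => (h2 p hp).ne') fun p hp =>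
      (Real.sqrt_pos.2 (h2 p hp)).ne'
    exact (contDiff_const.sub (h1.pow 2)).contDiffOn
  · exact (contDiff_fst.sub (h1.smul contDiff_const)).contDiffOn

theorem collarPoint_mem {p : EuclideanSpace ℝ (Fin 3) × (Fin n → EuclideanSpace ℝ (Fin 3))}
    (hp : p ∈ sphereTimesChains b) (h : |p.1 0| < 1) : collarPoint p ∈ collarDomain b := by
  have h1 : ‖p.1 - p.1 0 • e₁ 3‖ ^ 2 = 1 - p.1 0 ^ 2 := by
    have h2 := norm_sq_three p.1
    rw [hp.1] at h2
    rw [norm_sq_three]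
    simp
    linarith
  have h2 : 0 < 1 - p.1 0 ^ 2 := by
    have := (sq_lt_one_iff_abs_lt_one (p.1 0)).2 h
    linarith
  have hpi := Real.pi_pos
  obtain ⟨h3, h4⟩ := abs_lt.1 h
  refine ⟨?_, ?_, ?_, hp.2⟩
  · change |2 / Real.pi * Real.arcsin (p.1 0)| < 1
    have h5 := Real.neg_pi_div_two_lt_arcsin.2 h3
    have h6 := Real.arcsin_lt_pi_div_two.2 h4
    have h7 : |Real.arcsin (p.1 0)| < Real.pi / 2 := abs_lt.2 ⟨by linarith, h6⟩
    rw [abs_mul, abs_of_pos (by positivity)]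
    calc 2 / Real.pi * |Real.arcsin (p.1 0)| < 2 / Real.pi * (Real.pi / 2) := by gcongr
      _ = 1 := by field_simp
  · simp [collarPoint]
  · change ‖(√(1 - p.1 0 ^ 2))⁻¹ • (p.1 - p.1 0 • e₁ 3)‖ = 1
    rw [norm_smul, norm_inv, Real.norm_eq_abs, abs_of_nonneg (Real.sqrt_nonneg _), ← h1,
      Real.sqrt_sq (norm_nonneg _)]
    refine inv_mul_cancel₀ fun h5 => ?_
    rw [h5] at h1
    simp at h1
    linarith

/-- The inclusion of the bicollar into the product of the sphere with the chains. -/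
def collarMap (p : collarDomain b) : sphereTimesChains b :=
  ⟨(Real.sin (Real.pi / 2 * p.1.1) • e₁ 3 + Real.cos (Real.pi / 2 * p.1.1) • p.1.2.1, p.1.2.2), by
    rw [← halfSphere_bicollar p.2.1 p.2.2.2.1]
    exact norm_halfSphere _ (by simp [p.2.2.1]), p.2.2.2.2⟩

theorem smoothAt_collarMap (p : collarDomain b) :
    SmoothAt (fun p : collarDomain b => (collarMap p).1) p := by
  refine SmoothAt.of_contDiff (F := fun p : ℝ × EuclideanSpace ℝ (Fin 3) ×
    (Fin n → EuclideanSpace ℝ (Fin 3)) => (Real.sin (Real.pi / 2 * p.1) • e₁ 3 +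
      Real.cos (Real.pi / 2 * p.1) • p.2.1, p.2.2)) ?_ p
  have h1 : ContDiff ℝ ∞ fun p : ℝ × EuclideanSpace ℝ (Fin 3) ×
    (Fin n → EuclideanSpace ℝ (Fin 3)) => Real.pi / 2 * p.1 := by fun_prop
  refine ContDiff.prodMk (ContDiff.add ?_ ?_) (by fun_prop)
  · exact (Real.contDiff_sin.comp h1).smul contDiff_const
  · exact (Real.contDiff_cos.comp h1).smul (by fun_prop)

theorem doubleMap_bicollar (p : collarDomain b) :
    doubleMap (bicollar p) = Quotient.mk _ (collarMap p) := by
  have h1 : bicollar p = Double.incl (decide (0 ≤ p.1.1)) (Quotient.mk _ (radial p)) := by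
    by_cases h : 0 ≤ p.1.1 <;> simp [bicollar, h]
  rw [h1, doubleMap_incl]
  exact congrArg (Quotient.mk _)
    (Subtype.ext (Prod.ext (halfSphere_bicollar p.2.1 p.2.2.2.1) rfl))

theorem doubleMap_collarPoint {p : EuclideanSpace ℝ (Fin 3) ×
    (Fin n → EuclideanSpace ℝ (Fin 3))} (hp : p ∈ sphereTimesChains b) (h : |p.1 0| < 1) :
    doubleMap (bicollar ⟨collarPoint p, collarPoint_mem hp h⟩) = Quotient.mk _ ⟨p, hp⟩ := by
  rw [doubleMap_bicollar]
  obtain ⟨h3, h4⟩ := abs_lt.1 h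
  have h2 : 0 < 1 - p.1 0 ^ 2 := by
    have := (sq_lt_one_iff_abs_lt_one (p.1 0)).2 h
    linarith
  refine congrArg (Quotient.mk _) (Subtype.ext (Prod.ext ?_ rfl))
  have h5 : Real.pi / 2 * (2 / Real.pi * Real.arcsin (p.1 0)) = Real.arcsin (p.1 0) := by
    have := Real.pi_pos
    field_simp
  simp only [collarMap, collarPoint, h5, Real.sin_arcsin h3.le h4.le, Real.cos_arcsin]
  rw [smul_inv_smul₀ (Real.sqrt_pos.2 h2).ne']
  simp

/-- A smooth function on the double is smooth on the sphere bundle, around the poles. -/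
theorem smoothAt_of_smoothAt_disk {f : sphereTimesChains b → ℝ} {s : Bool}
    {h : diskTimesChains b → ℝ} (hf : ∀ p (hs : 0 ≤ sideSign s * p.1.1 0),
      f p = h ⟨_, diskPoint_mem p.2 hs⟩) {p : sphereTimesChains b}
    (hp : sideSign s * p.1.1 0 = 1)
    (hh : SmoothAt h ⟨_, diskPoint_mem (s := s) p.2 (by rw [hp]; exact zero_le_one)⟩) :
    SmoothAt f p := by
  obtain ⟨W, κ, hW, h1W, hκ, hκ'⟩ := exists_smooth_arccos_sq
  have hl : ContDiff ℝ ∞ fun p : EuclideanSpace ℝ (Fin 3) ×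
      (Fin n → EuclideanSpace ℝ (Fin 3)) => sideSign s * p.1 0 := by fun_prop
  have hU : IsOpen ((W ∩ Set.Ioi 0) ∩ (fun x => sincSqrt (κ x)) ⁻¹' Set.Ioi 0) :=
    ((contDiff_sincSqrt.continuous.comp_continuousOn hκ.continuousOn).mono
      Set.inter_subset_left).isOpen_inter_preimage (hW.inter isOpen_Ioi) isOpen_Ioi
  have hκ1 : κ 1 = 0 := by simp [hκ' 1 h1W le_rfl]
  -- The arc cosine is not smooth at `1`, but only its square is needed; its smooth extension `κ`
  -- gives an ambient extension of the disk coordinates near the pole.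
  refine hh.of_comp (F := fun p => (diskPoint (κ (sideSign s * p.1 0)) p.1, p.2))
    (hU.preimage hl.continuous) ?_ ?_ ?_ ?_
  · rw [Set.mem_preimage, hp]
    exact ⟨⟨h1W, Set.mem_Ioi.2 one_pos⟩, by simp [hκ1, sincSqrt_zero]⟩
  · refine ContDiffOn.prodMk (ContDiffOn.fun_smul (ContDiffOn.fun_inv (contDiffOn_const.mul ?_) ?_) ?_)
      contDiffOn_snd
    · exact contDiff_sincSqrt.comp_contDiffOn (hκ.comp hl.contDiffOn fun p hp => hp.1.1)
    · intro p hp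
      exact (mul_pos (by positivity) hp.2).ne'
    · exact ContDiff.contDiffOn (by fun_prop)
  · simp only [hp, hκ1, Real.arccos_one]
    simp
  · intro y hy
    have h2 : sideSign s * y.1.1 0 ≤ 1 := by
      refine (le_abs_self _).trans ?_
      rw [abs_sideSign_mul, ← y.2.1]
      exact PiLp.norm_apply_le y.1.1 0
    have h3 := hκ' _ hy.1.1 h2
    have h4 : 0 ≤ sideSign s * y.1.1 0 := le_of_lt hy.1.2
    simp only [h3]
    exact ⟨diskPoint_mem y.2 h4, hf y h4⟩

/-- The double of the disk bundle is isomorphic to the sphere bundle. -/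
theorem smoothIso_double [T2Space (SphereBundle b)] :
    SmoothIso (Double b) (SphereBundle b) := by
  -- Continuity of the inverse comes from compactness of the double and the Hausdorff property of
  -- the sphere bundle.
  let e : Double b ≃ₜ SphereBundle b := Continuous.homeoOfEquivCompactToT2
    (f := Equiv.ofBijective doubleMap ⟨doubleMap_injective, doubleMap_surjective⟩)
    continuous_doubleMap
  refine ⟨e, fun U f hU => ⟨fun hf => ⟨fun s => ?_, ?_⟩, fun hf => ?_⟩⟩
  · exact smoothOn_comp (smoothAt_halfMap s) (h := fun p => f (Quotient.mk _ p)) hf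
  · have h1 := smoothOn_comp smoothAt_collarMap (h := fun p => f (Quotient.mk _ p)) hf
    have h2 : (fun p : collarDomain b => f (e (bicollar p))) =
        fun p => f (Quotient.mk _ (collarMap p)) :=
      funext fun p => congrArg f (doubleMap_bicollar p)
    have h3 : bicollar ⁻¹' (e ⁻¹' U) =
        collarMap ⁻¹' (Quotient.mk (orbitSetoid 3 (sphereTimesChains b)) ⁻¹' U) := by
      ext p
      change doubleMap (bicollar p) ∈ U ↔ Quotient.mk _ (collarMap p) ∈ U
      rw [doubleMap_bicollar]
    rw [h2, h3]
    exact h1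
  · intro p hp
    -- Collar coordinates cover everything but the poles; at a pole the function is read in the disk
    -- centred there.
    by_cases h : |p.1.1 0| < 1
    · have h1 := hf.2 ⟨collarPoint p.1, collarPoint_mem p.2 h⟩ (by
        change doubleMap (bicollar _) ∈ U
        rw [doubleMap_collarPoint p.2 h]
        exact hp)
      refine SmoothAt.of_comp (x := p) h1 (W := {p | |p.1 0| < 1}) (F := collarPoint)
        (isOpen_lt (by fun_prop) continuous_const) h contDiffOn_collarPoint rfl fun y hy => ?_
      exact ⟨collarPoint_mem y.2 hy, congrArg f (doubleMap_collarPoint y.2 hy).symm⟩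
    · obtain ⟨s, hs⟩ := exists_side p.1.1
      have h1 : sideSign s * p.1.1 0 = 1 := by
        rw [← abs_of_nonneg hs, abs_sideSign_mul]
        refine le_antisymm ?_ (not_lt.1 h)
        rw [← p.2.1]
        exact PiLp.norm_apply_le p.1.1 0
      have h2 := hf.1 s
      refine smoothAt_of_smoothAt_disk (s := s)
        (h := fun x => f (e (Double.incl s (Quotient.mk _ x))))
        (fun y hy => congrArg f (doubleMap_diskPoint y.2 hy).symm) h1 (h2 _ ?_)
      change doubleMap (Double.incl s (Quotient.mk _ _)) ∈ U
      rw [doubleMap_diskPoint p.2 hs]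
      exact hp

end Double

end PolygonSpaces

end

/-- Here `m = n + 2`, so `α` is a chamber of `ℝᵐ⁻¹_↗`; `b` and `a` represent `α` and `α⁺`. -/
theorem mainTheorem6 (n : ℕ) (α : Set (Fin (n + 1) → ℝ)) (hα : PolygonSpaces.IsChamber α)
    (b : Fin (n + 1) → ℝ) (hb : b ∈ α)
    (a : Fin (n + 2) → ℝ) (ha : a ∈ PolygonSpaces.plusChamber α) :
    PolygonSpaces.AreDiffeomorphic (2 * (n + 2 - 3))
        (PolygonSpaces.PolygonSpace 3 a) (PolygonSpaces.SphereBundle b) ∧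
      PolygonSpaces.AreDiffeomorphic (2 * (n + 2 - 3))
        (PolygonSpaces.PolygonSpace 3 a) (PolygonSpaces.Double b) := by
  have h1 := (PolygonSpaces.equivariantDiffeo_plusChamber hα hb ha).smoothIso
  have h2 := PolygonSpaces.isSmoothManifold_polygonSpace (PolygonSpaces.genericOrdered_subset _
    (PolygonSpaces.mem_genericOrdered_of_mem_plusChamber ha))
  -- The Hausdorff property needed for the double is transported from the polygon space to the
  -- sphere bundle.
  have := (h2.of_smoothIso h1.symm).t2
  exact ⟨h1.areDiffeomorphic h2,
    (h1.trans PolygonSpaces.smoothIso_double.symm).areDiffeomorphic h2⟩
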